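/- **Setting.** Let $d\ge 1$, $I_d=\{1,\dots,d\}$, let $\mathcal S^d=\{\theta\in[0,\infty)^d:\sum_i\theta^i=1\}$, and let $\|\cdot\|$ be the maximum norm on $\mathbb R^d$. Put $\Delta_i z=(z^1-z^i,\dots,z^d-z^i)$, $\mathbf 1=(1,\dots,1)$ and $\|v\|_\sharp=\inf_{r\in\mathbb R}\|v+r\mathbf 1\|$. Let $c(i,\theta,\alpha)$, with $i\in I_d$, $\theta\in\mathcal S^d$, $\alpha\in[0,\infty)^d$, be a real-valued running cost such that: $c(i,\theta,\alpha)$ does not depend on $\alpha_i$; $c$ is Lipschitz in $\theta$, uniformly in $\alpha$; $c(i,\theta,\cdot)$ is continuous on $[0,\infty)^d$ and differentiable on $(0,\infty)^d$, where $\nabla_\alpha c$ is Lipschitz in $\theta$, uniformly in $\alpha$; there is $\gamma_0>0$ with $$c(i,\theta,\alpha')-c(i,\theta,\alpha)\ge\nabla_\alpha c(i,\theta,\alpha)\cdot(\alpha'-\alpha)+\gamma_0\sum_{j\ne i}(\alpha'_j-\alpha_j)^2$$ for all $i$, $\theta$, $\alpha\in(0,\infty)^d$, $\alpha'\in[0,\infty)^d$;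 and $c(i,\theta,\alpha)/\|\alpha\|\to\infty$ as $\alpha_j\to\infty$ with the other coordinates fixed, for each $j\neq i$. Define $$h(z,\theta,i)=\min_{\mu\in[0,\infty)^d}\bigl[c(i,\theta,\mu)+\mu\cdot\Delta_i z\bigr],$$ let $\alpha^*_j(z,\theta,i)$, $j\ne i$, be the coordinates of a minimizer (these are unique), and set $\alpha_i^*(z,\theta,i)=-\sum_{j\neq i}\alpha_j^*(z,\theta,i)$. A solution of the mean field game equations on $[a,b]$ is a pair $(\theta,u):[a,b]\to\mathcal S^d\times\mathbb R^d$ that is differentiable (one-sidedly at the endpoints) with $$\frac{d}{dt}\theta^i=\sum_j\theta^j\alpha^*_i(\Delta_j u,\theta,j),\qquad -\frac{d}{dt}u^i=h(\Delta_i u,\theta,i).\tag{1}$$ A stationary solution is a triplet $(\bar\theta,\bar u,\kappa)\in\mathcal S^d\times\mathbb R^d\times\mathbb R$ with $\sum_j\bar\theta^j\alpha_i^*(\Delta_j\bar u,\bar\theta,j)=0$ and $h(\Delta_i\bar u,\bar\theta,i)=\kappa$ for all $i$. **Hypotheses.** 1. (Uniform concavity.) For every $M$ there are $\gamma_i>0$,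 $i\in I_d$, such that for all $i$, all $\theta\in\mathcal S^d$ and all $z,w$ with $\|z\|_\sharp,\|w\|_\sharp\le M$, $$h(\Delta_i z,\theta,i)-h(\Delta_i w,\theta,i)-\alpha^*(\Delta_i w,\theta,i)\cdot(\Delta_i z-\Delta_i w)\le-\gamma_i\|\Delta_i z-\Delta_i w\|^2.$$ 2. (Monotonicity.) With $h(z,\theta)=(h(\Delta_1z,\theta,1),\dots,h(\Delta_dz,\theta,d))$, there is $\gamma>0$ such that for all $z,\tilde z\in\mathbb R^d$ and $\theta,\tilde\theta\in\mathcal S^d$, $$\theta\cdot(h(z,\tilde\theta)-h(z,\theta))+\tilde\theta\cdot(h(\tilde z,\theta)-h(\tilde z,\tilde\theta))\le-\gamma\|\theta-\tilde\theta\|^2.$$ 3. (Contractivity.) There is $M>0$ such that for all $\theta\in\mathcal S^d$, $i\in I_d$ and $u$ with $\|u\|_\sharp>M$: if $(\Delta_iu)^j\le0$ for all $j$, then $h(\Delta_iu,\theta,i)-\frac1d\sum_jh(\Delta_ju,\theta,j)<0$; and if $(\Delta_iu)^j\ge0$ for all $j$, then $h(\Delta_iu,\theta,i)-\frac1d\sum_jh(\Delta_ju,\theta,j)>0$.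 **Theorem 2.9.** Under these hypotheses: (a) There is $M_0$ such that for all $M\ge M_0$, all $T>0$ and every solution $(\theta,u)$ of (1) on $[0,T]$ with $\|u(T)\|_\sharp\le M$, one has $\|u(t)\|_\sharp\le M$ for all $t\in[0,T]$. (b) There is a stationary solution $(\bar\theta,\bar u,\kappa)$, and it is unique up to the addition of a multiple of $\mathbf 1$ to $\bar u$. (c) Let $\theta_0\in\mathcal S^d$ and let $\psi^i:\mathcal S^d\to\mathbb R$, $i\in I_d$, be Lipschitz. For each $T>0$ let $(\theta^T,u^T)$ be a solution of (1) on $[-T,T]$ with $\theta^T(-T)=\theta_0$ and $u^{T,i}(T)=\psi^i(\theta^T(T))$ for all $i$. Then $\theta^T(0)\to\bar\theta$ and $\|u^T(0)-\bar u\|_\sharp\to0$ as $T\to\infty$. -/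

import Mathlib

open Set Filter Topology

namespace MFG

/-- The difference operator `Δ_i z = (z^1 - z^i, …, z^d - z^i)`. -/
def diff {d : ℕ} (i : Fin d) (z : Fin d → ℝ) : Fin d → ℝ := fun j => z j - z i

/-- The seminorm `‖v‖_♯ = inf_r ‖v + r 𝟏‖` (`‖·‖` is the maximum norm of `ℝ^d`), which is the norm of
the class of `v` in `ℝ^d / ℝ`. -/
noncomputable def sharpNorm {d : ℕ} (v : Fin d → ℝ) : ℝ := ⨅ r : ℝ, ‖v + fun _ => r‖

/-- The standing assumptions on the running cost `c(i, θ, α)`, with `θ` in the probability simplex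
and `α` in the closed orthant `[0,∞)^d`; values of `c` elsewhere play no role.
Differentiability in `α` (and all that involves the gradient) is asked for in the open orthant only,
together with continuity on the closed orthant. Since `c i θ α` does not depend on `α i`, the quadratic
term in the convexity inequality runs over the coordinates `j ≠ i`. -/
structure IsRunningCost {d : ℕ} (c : Fin d → (Fin d → ℝ) → (Fin d → ℝ) → ℝ) : Prop where
  /-- `c` is Lipschitz in `θ`, uniformly in `α`. -/
  lipschitz : ∃ K : NNReal, ∀ i, ∀ α : Fin d → ℝ, (∀ j, 0 ≤ α j) →
    LipschitzOnWith K (fun θ => c i θ α) (stdSimplex ℝ (Fin d))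
  continuousOn : ∀ i, ∀ θ ∈ stdSimplex ℝ (Fin d), ContinuousOn (c i θ) {α | ∀ j, 0 ≤ α j}
  differentiableAt : ∀ i, ∀ θ ∈ stdSimplex ℝ (Fin d), ∀ α : Fin d → ℝ, (∀ j, 0 < α j) →
    DifferentiableAt ℝ (c i θ) α
  /-- `∂c/∂α` is Lipschitz in `θ`, uniformly in `α`. -/
  lipschitz_fderiv : ∃ K : NNReal, ∀ i, ∀ α : Fin d → ℝ, (∀ j, 0 < α j) →
    LipschitzOnWith K (fun θ => fderiv ℝ (c i θ) α) (stdSimplex ℝ (Fin d))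
  /-- `c i θ α` does not depend on `α i`. -/
  indep : ∀ i, ∀ θ ∈ stdSimplex ℝ (Fin d), ∀ α α' : Fin d → ℝ, (∀ j, 0 ≤ α j) → (∀ j, 0 ≤ α' j) →
    (∀ j, j ≠ i → α j = α' j) → c i θ α = c i θ α'
  /-- Uniform convexity in the coordinates `j ≠ i`. -/
  uniformConvex : ∃ γ : ℝ, 0 < γ ∧ ∀ i, ∀ θ ∈ stdSimplex ℝ (Fin d), ∀ α α' : Fin d → ℝ,
    (∀ j, 0 < α j) → (∀ j, 0 ≤ α' j) →
      fderiv ℝ (c i θ) α (α' - α) + γ * ∑ j ∈ Finset.univ.erase i, (α' j - α j) ^ 2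
        ≤ c i θ α' - c i θ α
  /-- Superlinearity in each `α j`, `j ≠ i`. -/
  superlinear : ∀ i, ∀ θ ∈ stdSimplex ℝ (Fin d), ∀ α : Fin d → ℝ, (∀ j, 0 ≤ α j) → ∀ j, j ≠ i →
    Tendsto (fun s : ℝ => c i θ (Function.update α j s) / ‖Function.update α j s‖) atTop atTop

/-- The terminal cost `ψ^i(θ)` is Lipschitz in `θ`. -/
def IsTerminalCost {d : ℕ} (ψ : Fin d → (Fin d → ℝ) → ℝ) : Prop :=
  ∃ K : NNReal, ∀ i, LipschitzOnWith K (ψ i) (stdSimplex ℝ (Fin d))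

/-- The function `μ ↦ c(i, θ, μ) + μ · Δ_i z`. -/
noncomputable def controlCost {d : ℕ} (c : Fin d → (Fin d → ℝ) → (Fin d → ℝ) → ℝ)
    (z θ : Fin d → ℝ) (i : Fin d) (μ : Fin d → ℝ) : ℝ :=
  c i θ μ + ∑ j, μ j * diff i z j

/-- The generalized Legendre transform
`h(z, θ, i) = min_{μ ∈ [0,∞)^d} c(i, θ, μ) + μ · Δ_i z`. -/
noncomputable def hamiltonian {d : ℕ} (c : Fin d → (Fin d → ℝ) → (Fin d → ℝ) → ℝ)
    (z θ : Fin d → ℝ) (i : Fin d) : ℝ :=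
  ⨅ μ : {μ : Fin d → ℝ // ∀ j, 0 ≤ μ j}, controlCost c z θ i μ

/-- `μ` is a minimizer of `c(i, θ, ·) + (·) · Δ_i z` over `[0,∞)^d`. -/
def IsMinimizer {d : ℕ} (c : Fin d → (Fin d → ℝ) → (Fin d → ℝ) → ℝ)
    (z θ : Fin d → ℝ) (i : Fin d) (μ : Fin d → ℝ) : Prop :=
  (∀ j, 0 ≤ μ j) ∧
    ∀ ν : Fin d → ℝ, (∀ j, 0 ≤ ν j) → controlCost c z θ i μ ≤ controlCost c z θ i ν

/-- The optimal rates `α*(z, θ, i)`: a minimizer, whose `i`-th coordinate (which the minimization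
leaves undetermined, the others being unique) is replaced by minus the sum of the others. -/
noncomputable def optControl {d : ℕ} (c : Fin d → (Fin d → ℝ) → (Fin d → ℝ) → ℝ)
    (z θ : Fin d → ℝ) (i : Fin d) : Fin d → ℝ := fun j =>
  if j = i then -∑ k ∈ Finset.univ.erase i, Classical.epsilon (IsMinimizer c z θ i) k
  else Classical.epsilon (IsMinimizer c z θ i) j

/-- `(θ, u)` is a solution on `[a, b]` of the mean field game equations
`dθ^i/dt = ∑_j θ^j α*_i(Δ_j u, θ, j)`, `-du^i/dt = h(Δ_i u, θ, i)`, with `θ` in the simplex. -/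
structure IsSolution {d : ℕ} (c : Fin d → (Fin d → ℝ) → (Fin d → ℝ) → ℝ) (a b : ℝ)
    (θ u : ℝ → Fin d → ℝ) : Prop where
  mem_simplex : ∀ t ∈ Icc a b, θ t ∈ stdSimplex ℝ (Fin d)
  kolmogorov : ∀ t ∈ Icc a b, ∀ i, HasDerivWithinAt (fun s => θ s i)
    (∑ j, θ t j * optControl c (diff j (u t)) (θ t) j i) (Icc a b) t
  hamiltonJacobi : ∀ t ∈ Icc a b, ∀ i, HasDerivWithinAt (fun s => u s i)
    (-hamiltonian c (diff i (u t)) (θ t) i) (Icc a b) t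

/-- `(θ, u, κ)` is a stationary solution (modulo constants in `u`). -/
structure IsStationary {d : ℕ} (c : Fin d → (Fin d → ℝ) → (Fin d → ℝ) → ℝ)
    (θ u : Fin d → ℝ) (κ : ℝ) : Prop where
  mem_simplex : θ ∈ stdSimplex ℝ (Fin d)
  kolmogorov : ∀ i, ∑ j, θ j * optControl c (diff j u) θ j i = 0
  hamiltonJacobi : ∀ i, hamiltonian c (diff i u) θ i = κ

/-- For every `M`, uniform concavity of `Δ_i z ↦ h(Δ_i z, θ, i)` on the set `‖z‖_♯ ≤ M`. -/
def LocallyUniformlyConcave {d : ℕ} (c : Fin d → (Fin d → ℝ) → (Fin d → ℝ) → ℝ) : Prop :=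
  ∀ M : ℝ, ∃ γ : Fin d → ℝ, (∀ i, 0 < γ i) ∧
    ∀ i, ∀ θ ∈ stdSimplex ℝ (Fin d), ∀ z w : Fin d → ℝ, sharpNorm z ≤ M → sharpNorm w ≤ M →
      hamiltonian c (diff i z) θ i - hamiltonian c (diff i w) θ i
          - ∑ j, optControl c (diff i w) θ i j * (diff i z j - diff i w j)
        ≤ -γ i * ‖diff i z - diff i w‖ ^ 2

/-- The monotonicity property of `h` in `θ`. -/
def HamiltonianMonotone {d : ℕ} (c : Fin d → (Fin d → ℝ) → (Fin d → ℝ) → ℝ) : Prop :=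
  ∃ γ : ℝ, 0 < γ ∧ ∀ θ ∈ stdSimplex ℝ (Fin d), ∀ θ' ∈ stdSimplex ℝ (Fin d), ∀ z z' : Fin d → ℝ,
    ∑ i, θ i * (hamiltonian c (diff i z) θ' i - hamiltonian c (diff i z) θ i)
        + ∑ i, θ' i * (hamiltonian c (diff i z') θ i - hamiltonian c (diff i z') θ' i)
      ≤ -γ * ‖θ - θ'‖ ^ 2

/-- The average `⟨h(u, θ, ·)⟩ = (1/d) ∑_j h(Δ_j u, θ, j)`. -/
noncomputable def meanHamiltonian {d : ℕ} (c : Fin d → (Fin d → ℝ) → (Fin d → ℝ) → ℝ)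
    (u θ : Fin d → ℝ) : ℝ := (1 / (d : ℝ)) * ∑ j, hamiltonian c (diff j u) θ j

/-- Contractivity of `h`. -/
def Contractive {d : ℕ} (c : Fin d → (Fin d → ℝ) → (Fin d → ℝ) → ℝ) : Prop :=
  ∃ M : ℝ, 0 < M ∧ ∀ θ ∈ stdSimplex ℝ (Fin d), ∀ (i : Fin d) (u : Fin d → ℝ), M < sharpNorm u →
    ((∀ j, diff i u j ≤ 0) → hamiltonian c (diff i u) θ i - meanHamiltonian c u θ < 0) ∧
    ((∀ j, 0 ≤ diff i u j) → 0 < hamiltonian c (diff i u) θ i - meanHamiltonian c u θ)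

end MFG

namespace MFG

variable {d : ℕ} {c : Fin d → (Fin d → ℝ) → (Fin d → ℝ) → ℝ}

/-! Everything rests on the pairing of measures with value functions. Concavity of `h` in `Δ_i z`,
with slope `α*`, together with monotonicity of `h` in `θ`, makes the map `(θ, u) ↦ (h, -drift)`
strongly monotone modulo constants in `u` (`exists_monotone`). Uniqueness of the stationary solution
is immediate from this.

For existence, convexity of the cost makes `α*` and `h` Lipschitz on bounded sets (`exists_bound`),
so the variational inequality on the simplex times the functions of oscillation at most `R` is
solved by a contraction. The constraints turn out to be inactive. Concavity forces every optimal
rate to be strictly positive (`optRate_pos`), hence mass flows into every empty state (`drift_pos`);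
this excludes the boundary of the simplex, and combined with contractivity it excludes oscillation
equal to `R`.

Contractivity also yields the a priori bound: where the oscillation of `u` is large and maximal, it
is strictly increasing in time, so it cannot exceed the terminal bound
(`Contractive.exists_sharpNorm_le`).

For the trend to equilibrium, `φ = (θ - θbar) · (u - ubar)` satisfies `φ' ≤ -lam |φ|`, so it is
exponentially small far from both endpoints. Since `-φ'` dominates the squared distance to
equilibrium, that distance is small at some time in `[0, ε]`, and Lipschitz bounds in time carry
this to time `0` (`IsStationary.exists_turnpike`). -/

/-! ### Invariance under the difference operators. -/

@[simp] lemma diff_diff (i j : Fin d) (z : Fin d → ℝ) : diff i (diff j z) = diff i z := by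
  funext k; simp [diff]

@[simp] lemma diff_self (i : Fin d) (z : Fin d → ℝ) : diff i z i = 0 := by simp [diff]

@[simp] lemma controlCost_diff (z θ : Fin d → ℝ) (i j : Fin d) :
    controlCost c (diff j z) θ i = controlCost c z θ i := by
  funext μ; simp [controlCost]

-- The control cost sees `z` only through `diff i z`. These simp lemmas strip the outer `diff` from
-- the equations and hypotheses, which are then used in terms of `u` itself.
@[simp] lemma hamiltonian_diff (z θ : Fin d → ℝ) (i j : Fin d) :
    hamiltonian c (diff j z) θ i = hamiltonian c z θ i := by
  simp [hamiltonian]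

@[simp] lemma optControl_diff (z θ : Fin d → ℝ) (i j : Fin d) :
    optControl c (diff j z) θ i = optControl c z θ i := by
  have : IsMinimizer c (diff j z) θ i = IsMinimizer c z θ i := by
    funext μ; simp [IsMinimizer]
  funext k; simp [optControl, this]

/-! ### Convexity of the running cost and optimal rates. -/

/-- Gradients are available only in the open orthant. Inequalities are proved there after a shift by
`ε` in every coordinate and reach the closed orthant through this limit. -/
lemma tendsto_cost_add_const (hc : IsRunningCost c) (i : Fin d) {θ : Fin d → ℝ}
    (hθ : θ ∈ stdSimplex ℝ (Fin d)) {x : Fin d → ℝ} (hx : ∀ j, 0 ≤ x j) :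
    Tendsto (fun ε : ℝ => c i θ (x + fun _ => ε)) (𝓝[>] 0) (𝓝 (c i θ x)) := by
  have h1 : ContinuousWithinAt (c i θ) {α | ∀ j, 0 ≤ α j} x := hc.continuousOn i θ hθ x hx
  refine h1.tendsto.comp (tendsto_nhdsWithin_iff.2 ⟨?_, ?_⟩)
  · have : Continuous (fun ε : ℝ => x + fun _ : Fin d => ε) := by fun_prop
    have h2 := this.tendsto 0
    have h3 : (x + fun _ : Fin d => (0 : ℝ)) = x := by funext j; simp
    rw [h3] at h2
    exact h2.mono_left nhdsWithin_le_nhds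
  · filter_upwards [self_mem_nhdsWithin] with ε hε j
    have : (0 : ℝ) < ε := hε
    simpa using add_nonneg (hx j) this.le

/-- Uniform midpoint convexity of the running cost on the closed orthant. -/
lemma IsRunningCost.midpoint_convex (hc : IsRunningCost c) :
    ∃ γ : ℝ, 0 < γ ∧ ∀ i, ∀ θ ∈ stdSimplex ℝ (Fin d), ∀ x y : Fin d → ℝ,
      (∀ j, 0 ≤ x j) → (∀ j, 0 ≤ y j) →
      2 * c i θ ((1 / 2 : ℝ) • (x + y)) + γ * ∑ j ∈ Finset.univ.erase i, (y j - x j) ^ 2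
        ≤ c i θ x + c i θ y := by
  obtain ⟨γ, hγ, h⟩ := hc.uniformConvex
  -- The gradient inequality at the midpoint is tested at both endpoints. The displacements are
  -- opposite, so the gradient terms cancel, and each quadratic term contributes `γ / 4`.
  refine ⟨γ / 2, by positivity, fun i θ hθ x y hx hy => ?_⟩
  have hm : ∀ j, 0 ≤ ((1 / 2 : ℝ) • (x + y)) j := fun j => by
    have := hx j; have := hy j
    simp; positivity
  refine le_of_tendsto_of_tendsto
    (((tendsto_cost_add_const hc i hθ hm).const_mul 2).add_const _)
    ((tendsto_cost_add_const hc i hθ hx).add (tendsto_cost_add_const hc i hθ hy)) ?_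
  filter_upwards [self_mem_nhdsWithin] with ε hε
  have hε : (0 : ℝ) < ε := hε
  have hmp : ∀ j, 0 < ((1 / 2 : ℝ) • (x + y) + fun _ => ε : Fin d → ℝ) j := fun j =>
    add_pos_of_nonneg_of_pos (hm j) hε
  have h1 := h i θ hθ _ (x + fun _ => ε) hmp (fun j => add_nonneg (hx j) hε.le)
  have h2 := h i θ hθ _ (y + fun _ => ε) hmp (fun j => add_nonneg (hy j) hε.le)
  have e1 : (x + fun _ => ε) - ((1 / 2 : ℝ) • (x + y) + fun _ => ε) = (1 / 2 : ℝ) • (x - y) := by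
    funext j; simp; ring
  have e2 : (y + fun _ => ε) - ((1 / 2 : ℝ) • (x + y) + fun _ => ε) = -((1 / 2 : ℝ) • (x - y)) := by
    funext j; simp; ring
  have s1 : ∑ j ∈ Finset.univ.erase i, ((x + fun _ => ε : Fin d → ℝ) j
      - ((1 / 2 : ℝ) • (x + y) + fun _ => ε : Fin d → ℝ) j) ^ 2
      = 1 / 4 * ∑ j ∈ Finset.univ.erase i, (y j - x j) ^ 2 := by
    rw [Finset.mul_sum]; refine Finset.sum_congr rfl fun j _ => ?_; simp; ring
  have s2 : ∑ j ∈ Finset.univ.erase i, ((y + fun _ => ε : Fin d → ℝ) j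
      - ((1 / 2 : ℝ) • (x + y) + fun _ => ε : Fin d → ℝ) j) ^ 2
      = 1 / 4 * ∑ j ∈ Finset.univ.erase i, (y j - x j) ^ 2 := by
    rw [Finset.mul_sum]; refine Finset.sum_congr rfl fun j _ => ?_; simp; ring
  rw [e1, s1] at h1
  rw [e2, s2, map_neg] at h2
  linarith

lemma norm_sq_le_sum_erase {i : Fin d} {v : Fin d → ℝ} (hv : v i = 0) :
    ‖v‖ ^ 2 ≤ ∑ j ∈ Finset.univ.erase i, v j ^ 2 := by
  have hs : 0 ≤ ∑ j ∈ Finset.univ.erase i, v j ^ 2 := Finset.sum_nonneg fun _ _ => sq_nonneg _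
  have : ‖v‖ ≤ √(∑ j ∈ Finset.univ.erase i, v j ^ 2) := by
    refine (pi_norm_le_iff_of_nonneg (Real.sqrt_nonneg _)).2 fun j => ?_
    by_cases hj : j = i
    · subst hj; simp [hv]
    · rw [Real.norm_eq_abs]
      refine Real.abs_le_sqrt ?_
      exact Finset.single_le_sum (f := fun j => v j ^ 2) (fun _ _ => sq_nonneg _)
        (Finset.mem_erase.2 ⟨hj, Finset.mem_univ j⟩)
  calc ‖v‖ ^ 2 ≤ √(∑ j ∈ Finset.univ.erase i, v j ^ 2) ^ 2 := by gcongr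
    _ = _ := Real.sq_sqrt hs

lemma abs_sum_mul_le (x y : Fin d → ℝ) : |∑ j, x j * y j| ≤ d * (‖x‖ * ‖y‖) := by
  calc |∑ j, x j * y j| ≤ ∑ j, |x j * y j| := Finset.abs_sum_le_sum_abs _ _
    _ ≤ ∑ _j : Fin d, ‖x‖ * ‖y‖ := by
      refine Finset.sum_le_sum fun j _ => ?_
      rw [abs_mul]
      exact mul_le_mul (norm_le_pi_norm x j) (norm_le_pi_norm y j) (abs_nonneg _) (norm_nonneg _)
    _ = _ := by simp

lemma controlCost_update (hc : IsRunningCost c) (i : Fin d) {θ : Fin d → ℝ}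
    (hθ : θ ∈ stdSimplex ℝ (Fin d)) (z : Fin d → ℝ) {μ : Fin d → ℝ} (hμ : ∀ j, 0 ≤ μ j) {s : ℝ}
    (hs : 0 ≤ s) : controlCost c z θ i (Function.update μ i s) = controlCost c z θ i μ := by
  unfold controlCost
  congr 1
  · refine hc.indep i θ hθ _ _ (fun j => ?_) hμ fun j hj => by simp [hj]
    by_cases hj : j = i
    · subst hj; simpa using hs
    · simpa [hj] using hμ j
  · refine Finset.sum_congr rfl fun j _ => ?_
    by_cases hj : j = i
    · subst hj; simp
    · simp [hj]

/-- Coercivity comes from the gradient inequality at `e = (1, …, 1)`: outside the ball of radius `B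
/ γ` the quadratic term beats all linear ones, and inside it compactness gives a minimum. -/
lemma exists_isMinimizer (hc : IsRunningCost c) (i : Fin d) {θ : Fin d → ℝ}
    (hθ : θ ∈ stdSimplex ℝ (Fin d)) (z : Fin d → ℝ) : ∃ μ, IsMinimizer c z θ i μ := by
  obtain ⟨γ, hγ, h⟩ := hc.uniformConvex
  set e : Fin d → ℝ := fun _ => 1 with he
  set B : ℝ := ‖fderiv ℝ (c i θ) e‖ + d * ‖diff i z‖ with hB
  have hB0 : 0 ≤ B := by positivity
  set S : Set (Fin d → ℝ) := Metric.closedBall e (B / γ) ∩ {α | ∀ j, 0 ≤ α j} with hS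
  have hcl : IsClosed {α : Fin d → ℝ | ∀ j, 0 ≤ α j} := by
    simp only [Set.ofPred_forall]
    exact isClosed_iInter fun j => isClosed_le continuous_const (continuous_apply j)
  have hcomp : IsCompact S := (isCompact_closedBall e _).inter_right hcl
  have heS : e ∈ S := ⟨Metric.mem_closedBall_self (by positivity), fun j => zero_le_one⟩
  have hcont : ContinuousOn (controlCost c z θ i) S := by
    refine ContinuousOn.add ((hc.continuousOn i θ hθ).mono inter_subset_right) ?_
    exact Continuous.continuousOn (by fun_prop)
  obtain ⟨μ, hμS, hμ⟩ := hcomp.exists_isMinOn ⟨e, heS⟩ hcont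
  refine ⟨μ, hμS.2, fun ν hν => ?_⟩
  -- The irrelevant `i`-th coordinate is set to that of `e`, so that the sum over `j ≠ i` controls
  -- the whole distance to `e`.
  rw [← controlCost_update hc i hθ z hν zero_le_one]
  set ν' := Function.update ν i 1 with hν'
  have hν'0 : ∀ j, 0 ≤ ν' j := fun j => by
    by_cases hj : j = i
    · subst hj; simp [hν']
    · simpa [hν', hj] using hν j
  by_cases hmem : ν' ∈ S
  · exact hμ hmem
  refine (hμ heS).trans ?_
  have hfar : B / γ < ‖ν' - e‖ := by
    by_contra! hle
    exact hmem ⟨by rwa [mem_closedBall_iff_norm], hν'0⟩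
  have h1 := h i θ hθ e ν' (fun j => one_pos) hν'0
  have h2 : ‖ν' - e‖ ^ 2 ≤ ∑ j ∈ Finset.univ.erase i, (ν' j - e j) ^ 2 :=
    norm_sq_le_sum_erase (by simp [hν', he])
  have h3 : -(‖fderiv ℝ (c i θ) e‖ * ‖ν' - e‖) ≤ fderiv ℝ (c i θ) e (ν' - e) :=
    (abs_le.1 ((fderiv ℝ (c i θ) e).le_opNorm (ν' - e))).1
  have h4 := (abs_le.1 (abs_sum_mul_le (ν' - e) (diff i z))).1
  have h5 : ∑ j, (ν' - e) j * diff i z j = ∑ j, ν' j * diff i z j - ∑ j, e j * diff i z j := by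
    rw [← Finset.sum_sub_distrib]
    exact Finset.sum_congr rfl fun j _ => by simp; ring
  have h6 : B * ‖ν' - e‖ ≤ γ * ‖ν' - e‖ ^ 2 := by
    rw [div_lt_iff₀ hγ] at hfar
    nlinarith [norm_nonneg (ν' - e)]
  have h7 : γ * ‖ν' - e‖ ^ 2 ≤ γ * ∑ j ∈ Finset.univ.erase i, (ν' j - e j) ^ 2 := by gcongr
  show controlCost c z θ i e ≤ controlCost c z θ i ν'
  unfold controlCost
  rw [hB] at h6
  nlinarith

/-- The minimizer whose `i`-th coordinate is `0`. -/
noncomputable def optRate (c : Fin d → (Fin d → ℝ) → (Fin d → ℝ) → ℝ)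
    (z θ : Fin d → ℝ) (i : Fin d) : Fin d → ℝ :=
  Function.update (Classical.epsilon (IsMinimizer c z θ i)) i 0

@[simp] lemma optRate_self (z θ : Fin d → ℝ) (i : Fin d) : optRate c z θ i i = 0 := by
  simp [optRate]

lemma optControl_of_ne (z θ : Fin d → ℝ) {i j : Fin d} (h : j ≠ i) :
    optControl c z θ i j = optRate c z θ i j := by
  simp [optControl, optRate, h]

lemma optControl_self (z θ : Fin d → ℝ) (i : Fin d) :
    optControl c z θ i i = -∑ j, optRate c z θ i j := by
  rw [← Finset.add_sum_erase _ _ (Finset.mem_univ i)]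
  simp only [optControl, optRate_self, if_true, zero_add]
  congr 1
  exact Finset.sum_congr rfl fun j hj => by simp [optRate, Finset.ne_of_mem_erase hj]

/-- The rates form a row of a Markov generator. This gives conservation of mass and makes pairings
with the rates blind to constants. -/
lemma sum_optControl (z θ : Fin d → ℝ) (i : Fin d) : ∑ j, optControl c z θ i j = 0 := by
  rw [← Finset.add_sum_erase _ _ (Finset.mem_univ i), optControl_self,
    ← Finset.add_sum_erase _ (optRate c z θ i) (Finset.mem_univ i), optRate_self,
    Finset.sum_congr rfl fun j hj => optControl_of_ne z θ (Finset.ne_of_mem_erase hj)]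
  ring

lemma sum_optControl_mul_diff (z θ w : Fin d → ℝ) (i : Fin d) :
    ∑ j, optControl c z θ i j * diff i w j = ∑ j, optControl c z θ i j * w j := by
  simp only [diff, mul_sub, Finset.sum_sub_distrib, ← Finset.sum_mul, sum_optControl]
  ring

lemma isMinimizer_optRate (hc : IsRunningCost c) (i : Fin d) {θ : Fin d → ℝ}
    (hθ : θ ∈ stdSimplex ℝ (Fin d)) (z : Fin d → ℝ) :
    IsMinimizer c z θ i (optRate c z θ i) := by
  have h := Classical.epsilon_spec (exists_isMinimizer hc i hθ z)
  refine ⟨fun j => ?_, fun ν hν => ?_⟩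
  · by_cases hj : j = i
    · subst hj; simp
    · simpa [optRate, hj] using h.1 j
  · rw [optRate, controlCost_update hc i hθ z h.1 le_rfl]
    exact h.2 ν hν

lemma optRate_nonneg (hc : IsRunningCost c) (i : Fin d) {θ : Fin d → ℝ}
    (hθ : θ ∈ stdSimplex ℝ (Fin d)) (z : Fin d → ℝ) (j : Fin d) : 0 ≤ optRate c z θ i j :=
  (isMinimizer_optRate hc i hθ z).1 j

lemma hamiltonian_eq (hc : IsRunningCost c) (i : Fin d) {θ : Fin d → ℝ}
    (hθ : θ ∈ stdSimplex ℝ (Fin d)) (z : Fin d → ℝ) :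
    hamiltonian c z θ i = controlCost c z θ i (optRate c z θ i) := by
  have h := isMinimizer_optRate hc i hθ z
  exact (IsLeast.csInf_eq ⟨⟨⟨_, h.1⟩, rfl⟩, by rintro _ ⟨⟨ν, hν⟩, rfl⟩; exact h.2 ν hν⟩)

lemma hamiltonian_le (hc : IsRunningCost c) (i : Fin d) {θ : Fin d → ℝ}
    (hθ : θ ∈ stdSimplex ℝ (Fin d)) (z : Fin d → ℝ) {ν : Fin d → ℝ} (hν : ∀ j, 0 ≤ ν j) :
    hamiltonian c z θ i ≤ controlCost c z θ i ν := by
  rw [hamiltonian_eq hc i hθ z]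
  exact (isMinimizer_optRate hc i hθ z).2 ν hν

/-- Quadratic growth of the control cost away from its minimizer. -/
lemma IsRunningCost.quadratic_growth (hc : IsRunningCost c) :
    ∃ γ : ℝ, 0 < γ ∧ ∀ i, ∀ θ ∈ stdSimplex ℝ (Fin d), ∀ z ν : Fin d → ℝ,
      (∀ j, 0 ≤ ν j) → ν i = 0 →
      controlCost c z θ i (optRate c z θ i) + γ * ‖ν - optRate c z θ i‖ ^ 2
        ≤ controlCost c z θ i ν := by
  obtain ⟨γ, hγ, h⟩ := hc.midpoint_convex
  refine ⟨γ, hγ, fun i θ hθ z ν hν hi => ?_⟩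
  have hm := isMinimizer_optRate hc i hθ z
  set μ := optRate c z θ i with hμ
  have h1 := h i θ hθ μ ν hm.1 hν
  -- The minimizer is compared with the midpoint, where midpoint convexity gains the quadratic term.
  have h2 := hm.2 ((1 / 2 : ℝ) • (μ + ν)) fun j => by
    have := hm.1 j; have := hν j
    simp; positivity
  have h3 : ‖ν - μ‖ ^ 2 ≤ ∑ j ∈ Finset.univ.erase i, (ν j - μ j) ^ 2 :=
    norm_sq_le_sum_erase (by simp [hμ, hi])
  have h4 : γ * ‖ν - μ‖ ^ 2 ≤ γ * ∑ j ∈ Finset.univ.erase i, (ν j - μ j) ^ 2 := by gcongr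
  have h5 : 2 * ∑ j, ((1 / 2 : ℝ) • (μ + ν)) j * diff i z j
      = ∑ j, μ j * diff i z j + ∑ j, ν j * diff i z j := by
    rw [← Finset.sum_add_distrib, Finset.mul_sum]
    exact Finset.sum_congr rfl fun j _ => by simp; ring
  unfold controlCost at *
  linarith

/-- The increments of the running cost in `α` are Lipschitz in `θ`. -/
lemma IsRunningCost.cost_diff_lipschitz (hc : IsRunningCost c) :
    ∃ K : ℝ, 0 ≤ K ∧ ∀ i, ∀ θ ∈ stdSimplex ℝ (Fin d), ∀ θ' ∈ stdSimplex ℝ (Fin d),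
      ∀ x y : Fin d → ℝ, (∀ j, 0 ≤ x j) → (∀ j, 0 ≤ y j) →
      (c i θ y - c i θ' y) - (c i θ x - c i θ' x) ≤ K * ‖θ - θ'‖ * ‖y - x‖ := by
  obtain ⟨K, hK⟩ := hc.lipschitz_fderiv
  refine ⟨K, K.2, fun i θ hθ θ' hθ' x y hx hy => ?_⟩
  refine le_of_tendsto (((tendsto_cost_add_const hc i hθ hy).sub
    (tendsto_cost_add_const hc i hθ' hy)).sub ((tendsto_cost_add_const hc i hθ hx).sub
    (tendsto_cost_add_const hc i hθ' hx))) ?_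
  filter_upwards [self_mem_nhdsWithin] with ε hε
  have hε : (0 : ℝ) < ε := hε
  have hconv : Convex ℝ {α : Fin d → ℝ | ∀ j, 0 < α j} := by
    intro a ha b hb s t hs ht hst j
    have h1 := ha j; have h2 := hb j
    simp only [Pi.add_apply, Pi.smul_apply, smul_eq_mul]
    rcases hs.eq_or_lt with rfl | hs
    · have : t = 1 := by linarith
      subst this; linarith
    · have := mul_pos hs h1
      have := mul_nonneg ht h2.le
      linarith
  -- Mean value inequality for `c i θ - c i θ'`, whose gradient is bounded by `K * ‖θ - θ'‖`.
  have h := hconv.norm_image_sub_le_of_norm_hasFDerivWithin_le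
    (f := fun α => c i θ α - c i θ' α) (C := K * ‖θ - θ'‖)
    (f' := fun α => fderiv ℝ (c i θ) α - fderiv ℝ (c i θ') α)
    (x := x + fun _ => ε) (y := y + fun _ => ε)
    (fun α hα => ((hc.differentiableAt i θ hθ α hα).hasFDerivAt.sub
      (hc.differentiableAt i θ' hθ' α hα).hasFDerivAt).hasFDerivWithinAt)
    (fun α hα => (hK i α hα).norm_sub_le hθ hθ')
    (fun j => add_pos_of_nonneg_of_pos (hx j) hε) (fun j => add_pos_of_nonneg_of_pos (hy j) hε)
  rw [add_sub_add_right_eq_sub] at h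
  exact (le_abs_self _).trans h

/-- The optimal rates are Lipschitz in `(Δ_i z, θ)`. -/
lemma IsRunningCost.optRate_lipschitz (hc : IsRunningCost c) :
    ∃ L : ℝ, 0 ≤ L ∧ ∀ i, ∀ θ ∈ stdSimplex ℝ (Fin d), ∀ θ' ∈ stdSimplex ℝ (Fin d),
      ∀ z z' : Fin d → ℝ,
      ‖optRate c z θ i - optRate c z' θ' i‖ ≤ L * (‖θ - θ'‖ + ‖diff i z - diff i z'‖) := by
  obtain ⟨γ, hγ, hg⟩ := hc.quadratic_growth
  obtain ⟨K, hK, hl⟩ := hc.cost_diff_lipschitz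
  refine ⟨(K + d) / γ, by positivity, fun i θ hθ θ' hθ' z z' => ?_⟩
  have ha := (isMinimizer_optRate hc i hθ z).1
  have hb := (isMinimizer_optRate hc i hθ' z').1
  -- Each minimizer is tested in the other's problem. In the sum only increments in `θ` and `z`
  -- survive, each linear in `‖a - b‖`, against a quadratic left side.
  have g1 := hg i θ hθ z (optRate c z' θ' i) hb (by simp)
  have g2 := hg i θ' hθ' z' (optRate c z θ i) ha (by simp)
  set a := optRate c z θ i
  set b := optRate c z' θ' i
  have h1 := hl i θ hθ θ' hθ' a b ha hb
  have h2 := (abs_le.1 (abs_sum_mul_le (b - a) (diff i z - diff i z'))).2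
  have h3 : ∑ j, (b - a) j * (diff i z - diff i z') j
      = ∑ j, b j * diff i z j - ∑ j, b j * diff i z' j
        - (∑ j, a j * diff i z j - ∑ j, a j * diff i z' j) := by
    simp only [← Finset.sum_sub_distrib]
    exact Finset.sum_congr rfl fun j _ => by simp; ring
  rw [norm_sub_rev b a] at *
  unfold controlCost at g1 g2
  have h4 : 2 * γ * ‖a - b‖ ^ 2
      ≤ (K * ‖θ - θ'‖ + d * ‖diff i z - diff i z'‖) * ‖a - b‖ := by nlinarith
  rw [div_mul_eq_mul_div, le_div_iff₀ hγ]
  have hd : (0 : ℝ) ≤ d := by positivity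
  have n1 := norm_nonneg (θ - θ')
  have n2 := norm_nonneg (diff i z - diff i z')
  rcases (norm_nonneg (a - b)).eq_or_lt with h0 | h0
  · rw [← h0]; rw [zero_mul]; positivity
  · have h5 : 2 * γ * ‖a - b‖ ≤ K * ‖θ - θ'‖ + d * ‖diff i z - diff i z'‖ := by
      refine le_of_mul_le_mul_right ?_ h0
      nlinarith
    nlinarith [mul_nonneg hK n2, mul_nonneg hd n1, mul_pos hγ h0]

/-! ### The seminorm modulo constants, and bounds on bounded sets. -/

lemma diff_sub (i : Fin d) (z w : Fin d → ℝ) : diff i (z - w) = diff i z - diff i w := by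
  funext j; simp [diff]; ring

lemma bddBelow_range_norm_add (v : Fin d → ℝ) : BddBelow (range fun r : ℝ => ‖v + fun _ => r‖) :=
  ⟨0, by rintro _ ⟨r, rfl⟩; exact norm_nonneg _⟩

lemma sharpNorm_nonneg (v : Fin d → ℝ) : 0 ≤ sharpNorm v :=
  Real.iInf_nonneg fun _ => norm_nonneg _

lemma sub_le_two_mul_sharpNorm (v : Fin d → ℝ) (i j : Fin d) : v i - v j ≤ 2 * sharpNorm v := by
  have : (v i - v j) / 2 ≤ sharpNorm v := by
    refine le_ciInf fun r => ?_
    have h1 := (abs_le.1 (norm_le_pi_norm (v + fun _ => r) i)).2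
    have h2 := (abs_le.1 (norm_le_pi_norm (v + fun _ => r) j)).1
    simp only [Pi.add_apply] at h1 h2
    linarith
  linarith

/-- `‖v‖_♯` is half of the oscillation of `v`. -/
lemma sharpNorm_le_iff (hd : 0 < d) {v : Fin d → ℝ} {M : ℝ} :
    sharpNorm v ≤ M ↔ ∀ i j, v i - v j ≤ 2 * M := by
  refine ⟨fun h i j => by linarith [sub_le_two_mul_sharpNorm v i j], fun h => ?_⟩
  have : Nonempty (Fin d) := ⟨⟨0, hd⟩⟩
  obtain ⟨i, hi⟩ := Finite.exists_max v
  obtain ⟨k, hk⟩ := Finite.exists_min v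
  refine (ciInf_le (bddBelow_range_norm_add v) (-((v i + v k) / 2))).trans ?_
  refine (pi_norm_le_iff_of_nonempty _).2 fun j => ?_
  have := h i k; have := hi j; have := hk j
  rw [Real.norm_eq_abs, abs_le]
  simp only [Pi.add_apply]
  constructor <;> linarith

lemma norm_diff_le_two_mul_sharpNorm (i : Fin d) (v : Fin d → ℝ) :
    ‖diff i v‖ ≤ 2 * sharpNorm v := by
  have h := sharpNorm_nonneg v
  refine (pi_norm_le_iff_of_nonneg (by positivity)).2 fun j => ?_
  rw [Real.norm_eq_abs, abs_le]
  have := sub_le_two_mul_sharpNorm v i j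
  have := sub_le_two_mul_sharpNorm v j i
  simp only [diff]
  constructor <;> linarith

lemma sharpNorm_le_norm_diff (i : Fin d) (v : Fin d → ℝ) : sharpNorm v ≤ ‖diff i v‖ := by
  refine (ciInf_le (bddBelow_range_norm_add v) (-v i)).trans (le_of_eq ?_)
  congr 1

lemma sharpNorm_le_norm (v : Fin d → ℝ) : sharpNorm v ≤ ‖v‖ := by
  refine (ciInf_le (bddBelow_range_norm_add v) 0).trans (le_of_eq ?_)
  congr 1; funext j; simp

lemma norm_diff_le (i : Fin d) (v : Fin d → ℝ) : ‖diff i v‖ ≤ 2 * ‖v‖ :=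
  (norm_diff_le_two_mul_sharpNorm i v).trans (by linarith [sharpNorm_le_norm v])

lemma sharpNorm_add_le (v w : Fin d → ℝ) : sharpNorm (v + w) ≤ sharpNorm v + sharpNorm w := by
  refine le_of_forall_pos_lt_add fun ε hε => ?_
  obtain ⟨r, hr⟩ := exists_lt_of_ciInf_lt (lt_add_of_pos_right (sharpNorm v) (half_pos hε))
  obtain ⟨s, hs⟩ := exists_lt_of_ciInf_lt (lt_add_of_pos_right (sharpNorm w) (half_pos hε))
  have h := ciInf_le (bddBelow_range_norm_add (v + w)) (r + s)
  have e : (v + w + fun _ => r + s) = (v + fun _ => r) + (w + fun _ => s) := by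
    funext j; simp; ring
  have := norm_add_le (v + fun _ => r) (w + fun _ => s)
  rw [← e] at this
  have h' : sharpNorm (v + w) ≤ ‖v + w + fun _ => r + s‖ := h
  linarith

lemma norm_sub_le_one_of_mem_stdSimplex {θ θ' : Fin d → ℝ} (hθ : θ ∈ stdSimplex ℝ (Fin d))
    (hθ' : θ' ∈ stdSimplex ℝ (Fin d)) : ‖θ - θ'‖ ≤ 1 := by
  refine (pi_norm_le_iff_of_nonneg zero_le_one).2 fun j => ?_
  have h : ∀ {η : Fin d → ℝ}, η ∈ stdSimplex ℝ (Fin d) → 0 ≤ η j ∧ η j ≤ 1 := fun hη =>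
    ⟨hη.1 j, hη.2 ▸ Finset.single_le_sum (fun i _ => hη.1 i) (Finset.mem_univ j)⟩
  have h1 := h hθ
  have h2 := h hθ'
  rw [Real.norm_eq_abs, abs_le, Pi.sub_apply]
  constructor <;> linarith

lemma abs_sum_le_mul_norm (v : Fin d → ℝ) : |∑ j, v j| ≤ d * ‖v‖ := by
  calc |∑ j, v j| ≤ ∑ j, |v j| := Finset.abs_sum_le_sum_abs _ _
    _ ≤ ∑ _j : Fin d, ‖v‖ := Finset.sum_le_sum fun j _ => norm_le_pi_norm v j
    _ = _ := by simp

lemma norm_optControl_sub_le (hd : 0 < d) (z z' θ θ' : Fin d → ℝ) (i : Fin d) :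
    ‖optControl c z θ i - optControl c z' θ' i‖
      ≤ d * ‖optRate c z θ i - optRate c z' θ' i‖ := by
  have h1 : (1 : ℝ) ≤ d := by exact_mod_cast hd
  have hn := norm_nonneg (optRate c z θ i - optRate c z' θ' i)
  refine (pi_norm_le_iff_of_nonneg (by positivity)).2 fun j => ?_
  by_cases hj : j = i
  · subst hj
    have := abs_sum_le_mul_norm (optRate c z θ j - optRate c z' θ' j)
    rw [Pi.sub_apply, optControl_self, optControl_self, Real.norm_eq_abs, ← abs_neg]
    convert this using 2
    simp only [Pi.sub_apply, Finset.sum_sub_distrib]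
    ring
  · rw [Pi.sub_apply, optControl_of_ne _ _ hj, optControl_of_ne _ _ hj]
    refine (norm_le_pi_norm (optRate c z θ i - optRate c z' θ' i) j).trans ?_
    nlinarith

lemma norm_optControl_le (hd : 0 < d) (z θ : Fin d → ℝ) (i : Fin d) :
    ‖optControl c z θ i‖ ≤ d * ‖optRate c z θ i‖ := by
  have h1 : (1 : ℝ) ≤ d := by exact_mod_cast hd
  have hn := norm_nonneg (optRate c z θ i)
  refine (pi_norm_le_iff_of_nonneg (by positivity)).2 fun j => ?_
  by_cases hj : j = i
  · subst hj
    rw [optControl_self, norm_neg]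
    exact abs_sum_le_mul_norm _
  · rw [optControl_of_ne _ _ hj]
    refine (norm_le_pi_norm (optRate c z θ i) j).trans ?_
    nlinarith

/-- Bounds and Lipschitz estimates for the optimal rates and the Hamiltonian, valid on bounded sets
of `ℝ^d / ℝ`. -/
lemma IsRunningCost.exists_bound (hd : 0 < d) (hc : IsRunningCost c) (M : ℝ) :
    ∃ A : ℝ, 0 ≤ A ∧
      (∀ i, ∀ θ ∈ stdSimplex ℝ (Fin d), ∀ z : Fin d → ℝ, sharpNorm z ≤ M →
        ‖optControl c z θ i‖ ≤ A ∧ |hamiltonian c z θ i| ≤ A) ∧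
      (∀ i, ∀ θ ∈ stdSimplex ℝ (Fin d), ∀ θ' ∈ stdSimplex ℝ (Fin d), ∀ z z' : Fin d → ℝ,
        sharpNorm z ≤ M → sharpNorm z' ≤ M →
        ‖optControl c z θ i - optControl c z' θ' i‖ ≤ A * (‖θ - θ'‖ + ‖z - z'‖) ∧
        |hamiltonian c z θ i - hamiltonian c z' θ' i| ≤ A * (‖θ - θ'‖ + ‖z - z'‖)) := by
  obtain ⟨L, hL, hl⟩ := hc.optRate_lipschitz
  obtain ⟨K, hK⟩ := hc.lipschitz
  have hK0 : (0 : ℝ) ≤ K := K.2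
  -- Reference point: a vertex of the simplex together with `z = 0`. Global Lipschitz continuity of
  -- the rates then bounds them when `sharpNorm z ≤ M`.
  set θr : Fin d → ℝ := Pi.single ⟨0, hd⟩ 1
  have hθr : θr ∈ stdSimplex ℝ (Fin d) := single_mem_stdSimplex ℝ _
  set R₀ := ∑ i, ‖optRate c 0 θr i‖
  set H₀ := ∑ i, |hamiltonian c 0 θr i|
  have hR₀ : 0 ≤ R₀ := Finset.sum_nonneg fun _ _ => norm_nonneg _
  have hH₀ : 0 ≤ H₀ := Finset.sum_nonneg fun _ _ => abs_nonneg _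
  set B := R₀ + L * (1 + 2 * |M|)
  have hB : 0 ≤ B := by positivity
  have hdz : ∀ i, ∀ z : Fin d → ℝ, sharpNorm z ≤ M → ‖diff i z‖ ≤ 2 * |M| := fun i z hz =>
    (norm_diff_le_two_mul_sharpNorm i z).trans (by linarith [le_abs_self M])
  have hd0 : ∀ i : Fin d, diff i 0 = 0 := fun i => by funext j; simp [diff]
  have hrate : ∀ i, ∀ θ ∈ stdSimplex ℝ (Fin d), ∀ z : Fin d → ℝ, ‖diff i z‖ ≤ 2 * |M| →
      ‖optRate c z θ i‖ ≤ B := by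
    intro i θ hθ z hz
    have h1 := hl i θ hθ θr hθr z 0
    have h2 : ‖optRate c 0 θr i‖ ≤ R₀ :=
      Finset.single_le_sum (f := fun i => ‖optRate c 0 θr i‖) (fun _ _ => norm_nonneg _)
        (Finset.mem_univ i)
    have h3 := norm_sub_norm_le (optRate c z θ i) (optRate c 0 θr i)
    have h4 : L * (‖θ - θr‖ + ‖diff i z - diff i 0‖) ≤ L * (1 + 2 * |M|) := by
      gcongr
      · exact norm_sub_le_one_of_mem_stdSimplex hθ hθr
      · rwa [hd0, sub_zero]
    linarith
  -- The optimal rate at `(z', θ')` is a competitor at `(z, θ)`; exchanging the roles gives the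
  -- two-sided estimate.
  have hham : ∀ i, ∀ θ ∈ stdSimplex ℝ (Fin d), ∀ θ' ∈ stdSimplex ℝ (Fin d), ∀ z z' : Fin d → ℝ,
      ‖diff i z'‖ ≤ 2 * |M| → hamiltonian c z θ i - hamiltonian c z' θ' i
        ≤ K * ‖θ - θ'‖ + d * (B * ‖diff i z - diff i z'‖) := by
    intro i θ hθ θ' hθ' z z' hz'
    have hμ := optRate_nonneg hc i hθ' z'
    have h1 := hamiltonian_le hc i hθ z hμ
    rw [hamiltonian_eq hc i hθ' z']
    have h2 := (le_abs_self _).trans ((hK i _ hμ).norm_sub_le hθ hθ')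
    have h3 := (le_abs_self _).trans
      (abs_sum_mul_le (optRate c z' θ' i) (diff i z - diff i z'))
    have h4 : (d : ℝ) * (‖optRate c z' θ' i‖ * ‖diff i z - diff i z'‖)
        ≤ d * (B * ‖diff i z - diff i z'‖) := by
      gcongr; exact hrate i θ' hθ' z' hz'
    simp only [Pi.sub_apply, mul_sub, Finset.sum_sub_distrib] at h3
    unfold controlCost at h1 ⊢
    linarith
  refine ⟨d * B + H₀ + K + d * (B * (2 * |M|)) + d * (L * 2) + 2 * (d * B), by positivity,
    fun i θ hθ z hz => ⟨?_, ?_⟩, fun i θ hθ θ' hθ' z z' hz hz' => ⟨?_, ?_⟩⟩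
  · have h1 := norm_optControl_le (c := c) hd z θ i
    have h2 : (d : ℝ) * ‖optRate c z θ i‖ ≤ d * B := by
      gcongr; exact hrate i θ hθ z (hdz i z hz)
    have h3 : 0 ≤ H₀ + K + d * (B * (2 * |M|)) + d * (L * 2) + 2 * (d * B) := by positivity
    linarith
  · have h0 : ‖diff i (0 : Fin d → ℝ)‖ ≤ 2 * |M| := by rw [hd0]; simp
    have h1 := hham i θ hθ θr hθr z 0 h0
    have h2 := hham i θr hθr θ hθ 0 z (hdz i z hz)
    rw [norm_sub_rev θr, norm_sub_rev (diff i 0)] at h2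
    have h3 : K * ‖θ - θr‖ + d * (B * ‖diff i z - diff i 0‖) ≤ K * 1 + d * (B * (2 * |M|)) := by
      gcongr
      · exact norm_sub_le_one_of_mem_stdSimplex hθ hθr
      · rw [hd0, sub_zero]; exact hdz i z hz
    have h4 : |hamiltonian c 0 θr i| ≤ H₀ :=
      Finset.single_le_sum (f := fun i => |hamiltonian c 0 θr i|) (fun _ _ => abs_nonneg _)
        (Finset.mem_univ i)
    have h5 : 0 ≤ d * B + d * (L * 2) + 2 * (d * B) := by positivity
    have h6 := abs_le.1 h4
    rw [abs_le]
    constructor <;> linarith [h6.1, h6.2]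
  · have h1 := norm_optControl_sub_le (c := c) hd z z' θ θ' i
    have h2 : (d : ℝ) * ‖optRate c z θ i - optRate c z' θ' i‖
        ≤ d * (L * (‖θ - θ'‖ + 2 * ‖z - z'‖)) := by
      gcongr
      refine (hl i θ hθ θ' hθ' z z').trans ?_
      gcongr
      rw [← diff_sub]; exact norm_diff_le i _
    have h3 : d * (L * (‖θ - θ'‖ + 2 * ‖z - z'‖)) ≤ d * (L * 2) * (‖θ - θ'‖ + ‖z - z'‖) := by
      have : 0 ≤ d * L * ‖θ - θ'‖ := by positivity
      linarith
    have h4 : 0 ≤ (d * B + H₀ + K + d * (B * (2 * |M|)) + 2 * (d * B))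
        * (‖θ - θ'‖ + ‖z - z'‖) := by positivity
    linarith
  · have h1 := hham i θ hθ θ' hθ' z z' (hdz i z' hz')
    have h2 := hham i θ' hθ' θ hθ z' z (hdz i z hz)
    rw [norm_sub_rev θ', norm_sub_rev (diff i z')] at h2
    have h3 : K * ‖θ - θ'‖ + d * (B * ‖diff i z - diff i z'‖)
        ≤ K * ‖θ - θ'‖ + d * (B * (2 * ‖z - z'‖)) := by
      gcongr
      rw [← diff_sub]; exact norm_diff_le i _
    have h4 : 0 ≤ (d * B + H₀ + d * (B * (2 * |M|)) + d * (L * 2)) * (‖θ - θ'‖ + ‖z - z'‖)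
        + K * ‖z - z'‖ + 2 * (d * B) * ‖θ - θ'‖ := by positivity
    rw [abs_le]
    constructor <;> linarith

/-! ### Positivity of the rates and of the inflow. -/

/-- Raising `z k` cannot lower `h`, because rates are nonnegative. If the rate to `k` vanished, the
slope of `h` in that direction would be zero and uniform concavity would force a strict decrease. -/
lemma optRate_pos (hc : IsRunningCost c) (hconc : LocallyUniformlyConcave c)
    {θ : Fin d → ℝ} (hθ : θ ∈ stdSimplex ℝ (Fin d)) (z : Fin d → ℝ) {i k : Fin d} (hk : k ≠ i) :
    0 < optRate c z θ i k := by
  refine (optRate_nonneg hc i hθ z k).lt_of_ne' fun h0 => ?_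
  set w : Fin d → ℝ := z + Pi.single k 1 with hw
  obtain ⟨γ, hγ, h⟩ := hconc (max (sharpNorm z) (sharpNorm w))
  have h1 := h i θ hθ w z (le_max_right _ _) (le_max_left _ _)
  simp only [hamiltonian_diff, optControl_diff] at h1
  have e : diff i w - diff i z = Pi.single k 1 := by
    rw [← diff_sub, hw, add_sub_cancel_left]
    funext j; simp [diff, hk.symm]
  have e2 : ∀ j, diff i w j - diff i z j = Pi.single (M := fun _ => ℝ) k 1 j := fun j => congrFun e j
  simp only [e2, e] at h1
  have e3 : ∑ j, optControl c z θ i j * Pi.single (M := fun _ => ℝ) k 1 j = 0 := by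
    rw [Finset.sum_eq_single k (fun j _ hj => by simp [hj]) (by simp)]
    simp [optControl_of_ne z θ hk, h0]
  have e4 : ‖(Pi.single k 1 : Fin d → ℝ)‖ = 1 := by simp [Pi.norm_single]
  rw [e3, e4] at h1
  have h2 : hamiltonian c z θ i ≤ hamiltonian c w θ i := by
    rw [hamiltonian_eq hc i hθ w]
    refine (hamiltonian_le hc i hθ z (optRate_nonneg hc i hθ w)).trans ?_
    unfold controlCost
    gcongr with j
    · exact optRate_nonneg hc i hθ w j
    · have := e2 j
      have h3 : 0 ≤ Pi.single (M := fun _ => ℝ) k 1 j := by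
        by_cases hj : j = k
        · subst hj; simp
        · simp [hj]
      linarith
  have := hγ i
  linarith

/-- The right-hand side of the Kolmogorov equation. -/
noncomputable def drift (c : Fin d → (Fin d → ℝ) → (Fin d → ℝ) → ℝ) (u θ : Fin d → ℝ)
    (i : Fin d) : ℝ := ∑ j, θ j * optControl c u θ j i

lemma sum_drift (u θ : Fin d → ℝ) : ∑ i, drift c u θ i = 0 := by
  simp only [drift]
  rw [Finset.sum_comm]
  simp [← Finset.mul_sum, sum_optControl]

/-- Duality between the forward operator on measures and the generator acting on functions. -/
lemma sum_drift_mul (u θ w : Fin d → ℝ) :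
    ∑ i, drift c u θ i * w i = ∑ j, θ j * ∑ i, optControl c u θ j i * diff j w i := by
  simp only [drift, sum_optControl_mul_diff, Finset.sum_mul, Finset.mul_sum]
  rw [Finset.sum_comm]
  exact Finset.sum_congr rfl fun j _ => Finset.sum_congr rfl fun i _ => by ring

/-- An empty state has no outflow, and it receives mass at a positive rate from any occupied state.
-/
lemma drift_pos (hc : IsRunningCost c) (hconc : LocallyUniformlyConcave c)
    {θ : Fin d → ℝ} (hθ : θ ∈ stdSimplex ℝ (Fin d)) (u : Fin d → ℝ) {k : Fin d} (hk : θ k = 0) :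
    0 < drift c u θ k := by
  obtain ⟨j, hj⟩ : ∃ j, 0 < θ j := by
    by_contra! h
    have := hθ.2
    have h2 : ∑ j, θ j ≤ 0 := Finset.sum_nonpos fun j _ => h j
    linarith
  refine Finset.sum_pos' (fun i _ => ?_) ⟨j, Finset.mem_univ j, ?_⟩
  · by_cases hi : k = i
    · subst hi; simp [hk]
    · rw [optControl_of_ne u θ hi]
      exact mul_nonneg (hθ.1 i) (optRate_pos hc hconc hθ u hi).le
  · have hne : k ≠ j := by rintro rfl; linarith
    rw [optControl_of_ne u θ hne]
    exact mul_pos hj (optRate_pos hc hconc hθ u hne)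

/-! ### Strong monotonicity of the coupled system. -/

/-- The monotonicity estimate behind uniqueness and the trend to equilibrium. -/
lemma exists_monotone (hd : 0 < d) (hconc : LocallyUniformlyConcave c)
    (hmono : HamiltonianMonotone c) (M : ℝ) :
    ∃ γ : ℝ, 0 < γ ∧ ∀ θ ∈ stdSimplex ℝ (Fin d), ∀ θ' ∈ stdSimplex ℝ (Fin d), ∀ u u' : Fin d → ℝ,
      sharpNorm u ≤ M → sharpNorm u' ≤ M →
      ∑ i, (θ i - θ' i) * (hamiltonian c u' θ' i - hamiltonian c u θ i)
        + ∑ i, (drift c u θ i - drift c u' θ' i) * (u i - u' i)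
        ≤ -γ * (‖θ - θ'‖ ^ 2 + sharpNorm (u - u') ^ 2) := by
  have : Nonempty (Fin d) := ⟨⟨0, hd⟩⟩
  obtain ⟨γ₁, hγ₁, hm⟩ := hmono
  obtain ⟨γ, hγ, hcc⟩ := hconc M
  obtain ⟨i₀, hi₀⟩ := Finite.exists_min γ
  refine ⟨min γ₁ (γ i₀), lt_min hγ₁ (hγ i₀), fun θ hθ θ' hθ' u u' hu hu' => ?_⟩
  have h1 := hm θ hθ θ' hθ' u' u
  simp only [hamiltonian_diff] at h1
  -- By duality the left side is the `θ`-average of the slopes of `h` at `u` applied to `u - u'`;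
  -- concavity bounds each of them. Used for both pairs, it leaves exactly the expression in the
  -- monotonicity hypothesis.
  have key : ∀ θ ∈ stdSimplex ℝ (Fin d), ∀ u u' : Fin d → ℝ, sharpNorm u ≤ M → sharpNorm u' ≤ M →
      ∑ i, drift c u θ i * (u i - u' i)
        ≤ ∑ i, θ i * (hamiltonian c u θ i - hamiltonian c u' θ i)
          - γ i₀ * sharpNorm (u - u') ^ 2 := by
    intro θ hθ u u' hu hu'
    have e : γ i₀ * sharpNorm (u - u') ^ 2 = ∑ i, θ i * (γ i₀ * sharpNorm (u - u') ^ 2) := by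
      rw [← Finset.sum_mul, hθ.2, one_mul]
    have e2 : ∑ i, drift c u θ i * (u i - u' i) = _ := sum_drift_mul (c := c) u θ (u - u')
    rw [e, e2, ← Finset.sum_sub_distrib]
    refine Finset.sum_le_sum fun i _ => ?_
    rw [← mul_sub]
    refine mul_le_mul_of_nonneg_left ?_ (hθ.1 i)
    have h2 := hcc i θ hθ u' u hu' hu
    simp only [hamiltonian_diff, optControl_diff] at h2
    have h3 : γ i₀ * sharpNorm (u - u') ^ 2 ≤ γ i * ‖diff i u' - diff i u‖ ^ 2 := by
      rw [norm_sub_rev, ← diff_sub]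
      have := sharpNorm_le_norm_diff i (u - u')
      have := sharpNorm_nonneg (u - u')
      have := (hγ i).le
      have := hi₀ i
      gcongr
    have h4 : ∑ j, optControl c u θ i j * diff i (u - u') j
        = -∑ j, optControl c u θ i j * (diff i u' j - diff i u j) := by
      rw [← Finset.sum_neg_distrib]
      refine Finset.sum_congr rfl fun j _ => ?_
      rw [diff_sub]; simp; ring
    rw [h4]
    linarith
  have h2 := key θ hθ u u' hu hu'
  have h3 := key θ' hθ' u' u hu' hu
  have e1 : ∑ i, (drift c u θ i - drift c u' θ' i) * (u i - u' i)
      = ∑ i, drift c u θ i * (u i - u' i) + ∑ i, drift c u' θ' i * (u' i - u i) := by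
    rw [← Finset.sum_add_distrib]; exact Finset.sum_congr rfl fun i _ => by ring
  have e2 : ∑ i, (θ i - θ' i) * (hamiltonian c u' θ' i - hamiltonian c u θ i)
      + (∑ i, θ i * (hamiltonian c u θ i - hamiltonian c u' θ i)
        + ∑ i, θ' i * (hamiltonian c u' θ' i - hamiltonian c u θ' i))
      = ∑ i, θ i * (hamiltonian c u' θ' i - hamiltonian c u' θ i)
        + ∑ i, θ' i * (hamiltonian c u θ i - hamiltonian c u θ' i) := by
    simp only [← Finset.sum_add_distrib]; exact Finset.sum_congr rfl fun i _ => by ring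
  have h5 : sharpNorm (u' - u) ^ 2 ≥ 0 := sq_nonneg _
  have h6 : min γ₁ (γ i₀) * ‖θ - θ'‖ ^ 2 ≤ γ₁ * ‖θ - θ'‖ ^ 2 := by
    gcongr; exact min_le_left _ _
  have h7 : min γ₁ (γ i₀) * sharpNorm (u - u') ^ 2 ≤ γ i₀ * sharpNorm (u - u') ^ 2 := by
    gcongr; exact min_le_right _ _
  have h8 := mul_nonneg (hγ i₀).le h5
  rw [e1]
  linarith

/-! ### Strongly monotone variational inequalities. -/

/-- A Lipschitz, strongly monotone map on a complete convex set solves the variational inequality. -/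
lemma exists_variationalInequality_inner {E : Type*} [NormedAddCommGroup E] [InnerProductSpace ℝ E]
    {K : Set E} (hne : K.Nonempty) (hK : IsComplete K) (hconv : Convex ℝ K) {G : E → E} {L γ : ℝ}
    (hL : ∀ x ∈ K, ∀ y ∈ K, ‖G x - G y‖ ≤ L * ‖x - y‖) (hγ : 0 < γ)
    (hm : ∀ x ∈ K, ∀ y ∈ K, γ * ‖x - y‖ ^ 2 ≤ inner ℝ (G x - G y) (x - y)) :
    ∃ x ∈ K, ∀ y ∈ K, 0 ≤ inner ℝ (G x) (y - x) := by
  have hP : ∀ u : E, ∃ v ∈ K, ∀ w ∈ K, inner ℝ (u - v) (w - v) ≤ 0 := fun u => by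
    obtain ⟨v, hv, h⟩ := exists_norm_eq_iInf_of_complete_convex hne hK hconv u
    exact ⟨v, hv, (norm_eq_iInf_iff_real_inner_le_zero hconv hv).1 h⟩
  choose P hPK hPi using hP
  have hPl : ∀ u v, ‖P u - P v‖ ≤ ‖u - v‖ := by
    intro u v
    have h1 := hPi u (P v) (hPK v)
    have h2 := hPi v (P u) (hPK u)
    have h3 : inner ℝ (u - P u) (P v - P u) + inner ℝ (v - P v) (P u - P v)
        = ‖P u - P v‖ ^ 2 - inner ℝ (u - v) (P u - P v) := by
      rw [← real_inner_self_eq_norm_sq, ← neg_sub (P u) (P v), inner_neg_right, ← sub_eq_neg_add,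
        ← inner_sub_left, ← inner_sub_left]
      congr 1; abel
    have h4 := real_inner_le_norm (u - v) (P u - P v)
    by_contra! hlt
    nlinarith [norm_nonneg (u - v)]
  -- With `τ = γ / N` the projected step `x ↦ P (x - τ • G x)` contracts by `√(L ^ 2 / N)`. Adding
  -- `γ ^ 2` keeps `N` positive and the ratio below `1` whatever `L` is.
  set N := L ^ 2 + γ ^ 2 with hN
  have hN0 : 0 < N := by positivity
  set τ := γ / N with hτ
  have hτ0 : 0 < τ := by positivity
  set q : NNReal := ⟨√(L ^ 2 / N), Real.sqrt_nonneg _⟩ with hq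
  have hq1 : q < 1 := by
    rw [← NNReal.coe_lt_coe]
    show √(L ^ 2 / N) < 1
    rw [Real.sqrt_lt' one_pos, one_pow, div_lt_one hN0]
    have : 0 < γ ^ 2 := by positivity
    linarith
  have hstep : ∀ x ∈ K, ∀ y ∈ K, ‖(x - τ • G x) - (y - τ • G y)‖ ≤ q * ‖x - y‖ := by
    intro x hx y hy
    have e : (x - τ • G x) - (y - τ • G y) = (x - y) - τ • (G x - G y) := by
      rw [smul_sub]; abel
    have h1 : ‖(x - y) - τ • (G x - G y)‖ ^ 2 ≤ L ^ 2 / N * ‖x - y‖ ^ 2 := by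
      rw [norm_sub_sq_real, inner_smul_right, norm_smul, mul_pow, Real.norm_eq_abs, sq_abs,
        real_inner_comm]
      have h2 := hm x hx y hy
      have h3 : ‖G x - G y‖ ^ 2 ≤ L ^ 2 * ‖x - y‖ ^ 2 := by
        rw [← mul_pow]
        have := hL x hx y hy
        gcongr
      have h4 : τ ^ 2 * ‖G x - G y‖ ^ 2 ≤ τ ^ 2 * (L ^ 2 * ‖x - y‖ ^ 2) := by gcongr
      have h5 : τ * (γ * ‖x - y‖ ^ 2) ≤ τ * inner ℝ (G x - G y) (x - y) := by gcongr
      have h6 : 1 - 2 * (τ * γ) + τ ^ 2 * L ^ 2 ≤ L ^ 2 / N := by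
        have e1 : L ^ 2 / N = 1 - τ * γ := by rw [hτ, hN]; field_simp; ring
        have e2 : τ ^ 2 * L ^ 2 = τ * γ * (L ^ 2 / N) := by rw [hτ]; field_simp
        rw [e2, e1]
        nlinarith [sq_nonneg (τ * γ)]
      nlinarith [mul_le_mul_of_nonneg_right h6 (sq_nonneg ‖x - y‖)]
    rw [e]
    refine le_of_sq_le_sq ?_ (by positivity)
    rw [mul_pow]
    show _ ≤ √(L ^ 2 / N) ^ 2 * _
    rwa [Real.sq_sqrt (by positivity)]
  let f : K → K := fun x => ⟨P (x - τ • G x), hPK _⟩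
  have hf : ContractingWith q f := by
    refine ⟨hq1, LipschitzWith.of_dist_le_mul fun x y => ?_⟩
    rw [Subtype.dist_eq, Subtype.dist_eq, dist_eq_norm, dist_eq_norm]
    exact (hPl _ _).trans (hstep x x.2 y y.2)
  have := hK.completeSpace_coe
  have : Nonempty K := hne.to_subtype
  set x := ContractingWith.fixedPoint f hf
  have hx : P (x - τ • G x) = x := congrArg Subtype.val hf.fixedPoint_isFixedPt
  refine ⟨x, x.2, fun y hy => ?_⟩
  -- The obtuse-angle property of the projection at the fixed point is the variational inequality
  -- times `τ`.
  have h := hPi (x - τ • G x) y hy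
  rw [hx, sub_sub_cancel_left, inner_neg_left, inner_smul_left] at h
  simp only [conj_trivial] at h
  by_contra! hlt
  nlinarith

lemma exists_variationalInequality {ι : Type*} [Fintype ι] {K : Set (ι → ℝ)} (hne : K.Nonempty)
    (hK : IsClosed K) (hconv : Convex ℝ K) {G : (ι → ℝ) → ι → ℝ} {L γ : ℝ} (hL0 : 0 ≤ L)
    (hL : ∀ x ∈ K, ∀ y ∈ K, ‖G x - G y‖ ≤ L * ‖x - y‖) (hγ : 0 < γ)
    (hm : ∀ x ∈ K, ∀ y ∈ K, γ * ‖x - y‖ ^ 2 ≤ ∑ i, (G x i - G y i) * (x i - y i)) :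
    ∃ x ∈ K, ∀ y ∈ K, 0 ≤ ∑ i, G x i * (y i - x i) := by
  -- Constant comparing the maximum and Euclidean norms; the `+ 1` keeps it positive for empty `ι`.
  set n : ℝ := Fintype.card ι + 1
  have hn : 0 < n := by positivity
  have hup : ∀ v : ι → ℝ, ‖WithLp.toLp 2 v‖ ^ 2 ≤ n * ‖v‖ ^ 2 := by
    intro v
    rw [EuclideanSpace.norm_sq_eq]
    calc ∑ i, ‖v i‖ ^ 2 ≤ ∑ _i : ι, ‖v‖ ^ 2 := by
          gcongr with i; exact norm_le_pi_norm v i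
      _ = Fintype.card ι * ‖v‖ ^ 2 := by simp
      _ ≤ n * ‖v‖ ^ 2 := by gcongr; simp [n]
  have hlow : ∀ v : ι → ℝ, ‖v‖ ≤ ‖WithLp.toLp 2 v‖ := fun v =>
    (pi_norm_le_iff_of_nonneg (norm_nonneg _)).2 fun i => PiLp.norm_apply_le (WithLp.toLp 2 v) i
  have hcont : Continuous (WithLp.ofLp : EuclideanSpace ℝ ι → ι → ℝ) := PiLp.continuous_ofLp 2 _
  have hA : ∀ x ∈ (WithLp.ofLp ⁻¹' K : Set (EuclideanSpace ℝ ι)), ∀ y ∈ (WithLp.ofLp ⁻¹' K :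
      Set (EuclideanSpace ℝ ι)),
      ‖WithLp.toLp 2 (G x.ofLp) - WithLp.toLp 2 (G y.ofLp)‖ ≤ n * L * ‖x - y‖ := by
    intro x hx y hy
    rw [← WithLp.toLp_sub]
    refine le_of_sq_le_sq ?_ (by positivity)
    have h1 := hL _ hx _ hy
    have h2 := hlow (x.ofLp - y.ofLp)
    have h3 : (1 : ℝ) ≤ n := by simp [n]
    calc _ ≤ n * ‖G x.ofLp - G y.ofLp‖ ^ 2 := hup _
      _ ≤ n * (L * ‖x.ofLp - y.ofLp‖) ^ 2 := by gcongr
      _ ≤ n ^ 2 * (L * ‖x - y‖) ^ 2 := by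
        gcongr
        · nlinarith
        · exact h2
      _ = _ := by ring
  have hB : ∀ x ∈ (WithLp.ofLp ⁻¹' K : Set (EuclideanSpace ℝ ι)), ∀ y ∈ (WithLp.ofLp ⁻¹' K :
      Set (EuclideanSpace ℝ ι)), γ / n * ‖x - y‖ ^ 2
      ≤ inner ℝ (WithLp.toLp 2 (G x.ofLp) - WithLp.toLp 2 (G y.ofLp)) (x - y) := by
    intro x hx y hy
    have h1 := hm _ hx _ hy
    have h2 := hup (x.ofLp - y.ofLp)
    have e : inner ℝ (WithLp.toLp 2 (G x.ofLp) - WithLp.toLp 2 (G y.ofLp)) (x - y)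
        = ∑ i, (G x.ofLp i - G y.ofLp i) * (x.ofLp i - y.ofLp i) := by
      simp [PiLp.inner_apply, mul_comm]
    rw [e]
    refine le_trans ?_ h1
    rw [div_mul_eq_mul_div, div_le_iff₀ hn]
    have h3 : ‖x - y‖ ^ 2 ≤ n * ‖x.ofLp - y.ofLp‖ ^ 2 := h2
    nlinarith
  obtain ⟨x, hx, h⟩ := exists_variationalInequality_inner (E := EuclideanSpace ℝ ι)
    (K := WithLp.ofLp ⁻¹' K) (G := fun x => WithLp.toLp 2 (G x.ofLp)) (L := n * L) (γ := γ / n)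
    (by obtain ⟨x, hx⟩ := hne; exact ⟨WithLp.toLp 2 x, hx⟩) (hK.preimage hcont).isComplete
    (fun a ha b hb s t hs ht hst => hconv ha hb hs ht hst) hA (by positivity) hB
  refine ⟨x.ofLp, hx, fun y hy => ?_⟩
  have := h (WithLp.toLp 2 y) hy
  simpa [PiLp.inner_apply, mul_comm] using this

/-! ### Stationary solutions. -/

lemma abs_drift_le {u θ : Fin d → ℝ} {A : ℝ} (hθ : θ ∈ stdSimplex ℝ (Fin d))
    (hA : ∀ j, ‖optControl c u θ j‖ ≤ A) (i : Fin d) : |drift c u θ i| ≤ A := by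
  calc |drift c u θ i| ≤ ∑ j, |θ j * optControl c u θ j i| := Finset.abs_sum_le_sum_abs _ _
    _ ≤ ∑ j, θ j * A := by
      refine Finset.sum_le_sum fun j _ => ?_
      rw [abs_mul, abs_of_nonneg (hθ.1 j)]
      exact mul_le_mul_of_nonneg_left ((norm_le_pi_norm _ i).trans (hA j)) (hθ.1 j)
    _ = A := by rw [← Finset.sum_mul, hθ.2, one_mul]

lemma abs_drift_sub_le {u u' θ θ' : Fin d → ℝ} {A B : ℝ} (hθ' : θ' ∈ stdSimplex ℝ (Fin d))
    (hA : ∀ j, ‖optControl c u θ j‖ ≤ A)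
    (hB : ∀ j, ‖optControl c u θ j - optControl c u' θ' j‖ ≤ B) (i : Fin d) :
    |drift c u θ i - drift c u' θ' i| ≤ d * (‖θ - θ'‖ * A) + B := by
  have e : drift c u θ i - drift c u' θ' i = ∑ j, ((θ - θ') j * optControl c u θ j i
      + θ' j * (optControl c u θ j - optControl c u' θ' j) i) := by
    simp only [drift, ← Finset.sum_sub_distrib]
    exact Finset.sum_congr rfl fun j _ => by simp; ring
  rw [e]
  calc _ ≤ ∑ j, |(θ - θ') j * optControl c u θ j i
      + θ' j * (optControl c u θ j - optControl c u' θ' j) i| := Finset.abs_sum_le_sum_abs _ _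
    _ ≤ ∑ j, (‖θ - θ'‖ * A + θ' j * B) := by
      refine Finset.sum_le_sum fun j _ => (abs_add_le _ _).trans ?_
      rw [abs_mul, abs_mul, abs_of_nonneg (hθ'.1 j)]
      refine add_le_add (mul_le_mul (norm_le_pi_norm (θ - θ') j)
        ((norm_le_pi_norm _ i).trans (hA j)) (abs_nonneg _) (norm_nonneg _)) ?_
      exact mul_le_mul_of_nonneg_left ((norm_le_pi_norm _ i).trans (hB j)) (hθ'.1 j)
    _ = _ := by rw [Finset.sum_add_distrib, ← Finset.sum_mul Finset.univ θ', hθ'.2]; simp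

/-- On mean-zero vectors the seminorm controls the norm, which turns monotonicity modulo constants
into strong monotonicity. -/
lemma norm_le_two_mul_sharpNorm {w : Fin d → ℝ} (hw : ∑ i, w i = 0) :
    ‖w‖ ≤ 2 * sharpNorm w := by
  have h0 := sharpNorm_nonneg w
  refine (pi_norm_le_iff_of_nonneg (by positivity)).2 fun i => ?_
  have hd : (0 : ℝ) < d := by exact_mod_cast i.pos
  have e : ∑ j, (w i - w j) = d * w i := by rw [Finset.sum_sub_distrib, hw]; simp
  have h1 : ∑ j, (w i - w j) ≤ ∑ _j : Fin d, 2 * sharpNorm w :=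
    Finset.sum_le_sum fun j _ => sub_le_two_mul_sharpNorm w i j
  have h2 : ∑ _j : Fin d, -(2 * sharpNorm w) ≤ ∑ j, (w i - w j) :=
    Finset.sum_le_sum fun j _ => by linarith [sub_le_two_mul_sharpNorm w j i]
  simp only [Finset.sum_const, Finset.card_univ, Fintype.card_fin, nsmul_eq_mul] at h1 h2
  rw [e] at h1 h2
  rw [Real.norm_eq_abs, abs_le]
  exact ⟨le_of_mul_le_mul_left h2 hd, le_of_mul_le_mul_left h1 hd⟩

/-- The variational inequality of the stationary problem, with the constraint that the oscillation
of the value function is at most `R`. -/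
lemma exists_stationary_variationalInequality (hd : 0 < d) (hc : IsRunningCost c)
    (hconc : LocallyUniformlyConcave c) (hmono : HamiltonianMonotone c) {R : ℝ} (hR : 0 ≤ R) :
    ∃ θ ∈ stdSimplex ℝ (Fin d), ∃ u : Fin d → ℝ, (∀ i j, u i - u j ≤ R) ∧
      ∀ θ' ∈ stdSimplex ℝ (Fin d), ∀ v : Fin d → ℝ, (∀ i j, v i - v j ≤ R) →
        0 ≤ ∑ i, hamiltonian c u θ i * (θ' i - θ i) - ∑ i, drift c u θ i * (v i - u i) := by
  obtain ⟨A, hA, hb, hl⟩ := hc.exists_bound hd R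
  obtain ⟨γ, hγ, hm⟩ := exists_monotone hd hconc hmono R
  set K : Set (Fin d ⊕ Fin d → ℝ) := {x | (x ∘ Sum.inl ∈ stdSimplex ℝ (Fin d) ∧
    ∑ i, x (Sum.inr i) = 0) ∧ ∀ i j, x (Sum.inr i) - x (Sum.inr j) ≤ R} with hK
  have hsharp : ∀ x ∈ K, sharpNorm (x ∘ Sum.inr) ≤ R := fun x hx =>
    (sharpNorm_le_iff hd).2 fun i j => (hx.2 i j).trans (by linarith)
  have hnorm1 : ∀ x y : Fin d ⊕ Fin d → ℝ, ‖x ∘ Sum.inl - y ∘ Sum.inl‖ ≤ ‖x - y‖ := fun x y =>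
    (pi_norm_le_iff_of_nonneg (norm_nonneg _)).2 fun i => norm_le_pi_norm (x - y) (Sum.inl i)
  have hnorm2 : ∀ x y : Fin d ⊕ Fin d → ℝ, ‖x ∘ Sum.inr - y ∘ Sum.inr‖ ≤ ‖x - y‖ := fun x y =>
    (pi_norm_le_iff_of_nonneg (norm_nonneg _)).2 fun i => norm_le_pi_norm (x - y) (Sum.inr i)
  have hKcl : IsClosed K := by
    have h1 : IsClosed {x : Fin d ⊕ Fin d → ℝ | x ∘ Sum.inl ∈ stdSimplex ℝ (Fin d)} :=
      (isCompact_stdSimplex ℝ (Fin d)).isClosed.preimage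
        (f := fun x : Fin d ⊕ Fin d → ℝ => x ∘ Sum.inl) (by fun_prop)
    have h2 : IsClosed {x : Fin d ⊕ Fin d → ℝ | ∑ i, x (Sum.inr i) = 0} :=
      isClosed_eq (by fun_prop) continuous_const
    have h3 : IsClosed {x : Fin d ⊕ Fin d → ℝ | ∀ i j, x (Sum.inr i) - x (Sum.inr j) ≤ R} := by
      simp only [Set.ofPred_forall]
      exact isClosed_iInter fun i => isClosed_iInter fun j =>
        isClosed_le (by fun_prop) continuous_const
    exact (h1.inter h2).inter h3
  -- The sum type carries `θ` on the left and a mean-zero `u` on the right. The factor `1 / 4` pays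
  -- for `‖·‖ ≤ 2 * sharpNorm` in the second component.
  obtain ⟨x, hx, hvi⟩ := exists_variationalInequality (K := K)
    (G := fun x => Sum.elim (hamiltonian c (x ∘ Sum.inr) (x ∘ Sum.inl))
      (fun i => -drift c (x ∘ Sum.inr) (x ∘ Sum.inl) i)) (L := d * A + 2 * A) (γ := γ / 4)
    ⟨Sum.elim (Pi.single ⟨0, hd⟩ 1) 0,
      ⟨single_mem_stdSimplex ℝ (⟨0, hd⟩ : Fin d), by simp⟩,
      fun i j => by simpa using hR⟩
    hKcl
    (by
      intro x hx y hy s t hs ht hst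
      refine ⟨⟨convex_stdSimplex ℝ (Fin d) hx.1.1 hy.1.1 hs ht hst, ?_⟩, fun i j => ?_⟩
      · simp [Finset.sum_add_distrib, ← Finset.mul_sum, hx.1.2, hy.1.2]
      · have h1 := mul_le_mul_of_nonneg_left (hx.2 i j) hs
        have h2 := mul_le_mul_of_nonneg_left (hy.2 i j) ht
        have h3 : s * R + t * R = R := by rw [← add_mul, hst, one_mul]
        simp only [Pi.add_apply, Pi.smul_apply, smul_eq_mul]
        linarith)
    (by positivity)
    (by
      intro x hx y hy
      have hn := norm_nonneg (x - y)
      have n1 := hnorm1 x y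
      have n2 := hnorm2 x y
      have h2 : A * (‖x ∘ Sum.inl - y ∘ Sum.inl‖ + ‖x ∘ Sum.inr - y ∘ Sum.inr‖)
          ≤ 2 * A * ‖x - y‖ := by nlinarith
      have h3 : d * (‖x ∘ Sum.inl - y ∘ Sum.inl‖ * A) ≤ d * (‖x - y‖ * A) := by gcongr
      have h4 : 0 ≤ d * (‖x - y‖ * A) := by positivity
      refine (pi_norm_le_iff_of_nonneg (by positivity)).2 (Sum.rec (fun i => ?_) fun i => ?_)
      · have h1 := (hl i _ hx.1.1 _ hy.1.1 _ _ (hsharp x hx) (hsharp y hy)).2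
        simp only [Pi.sub_apply, Sum.elim_inl, Real.norm_eq_abs]
        linarith
      · have h1 := abs_drift_sub_le (c := c) hy.1.1
          (fun j => (hb j _ hx.1.1 _ (hsharp x hx)).1)
          (fun j => (hl j _ hx.1.1 _ hy.1.1 _ _ (hsharp x hx) (hsharp y hy)).1) i
        simp only [Pi.sub_apply, Sum.elim_inr, Real.norm_eq_abs]
        rw [neg_sub_neg, abs_sub_comm]
        linarith)
    (by positivity)
    (by
      intro x hx y hy
      have h1 := hm _ hx.1.1 _ hy.1.1 _ _ (hsharp x hx) (hsharp y hy)
      have h2 : ‖x ∘ Sum.inr - y ∘ Sum.inr‖ ≤ 2 * sharpNorm (x ∘ Sum.inr - y ∘ Sum.inr) :=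
        norm_le_two_mul_sharpNorm (by
          simp only [Pi.sub_apply, Function.comp_apply, Finset.sum_sub_distrib, hx.1.2, hy.1.2,
            sub_zero])
      set a := ‖x ∘ Sum.inl - y ∘ Sum.inl‖
      set b := sharpNorm (x ∘ Sum.inr - y ∘ Sum.inr)
      have ha : 0 ≤ a := norm_nonneg _
      have hb : 0 ≤ b := sharpNorm_nonneg _
      have h3 : ‖x - y‖ ≤ max a (2 * b) := by
        refine (pi_norm_le_iff_of_nonneg (le_max_of_le_left ha)).2
          (Sum.rec (fun i => ?_) fun i => ?_)
        · exact le_max_of_le_left (norm_le_pi_norm (x ∘ Sum.inl - y ∘ Sum.inl) i)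
        · exact le_max_of_le_right
            ((norm_le_pi_norm (x ∘ Sum.inr - y ∘ Sum.inr) i).trans h2)
      have h4 : ‖x - y‖ ^ 2 ≤ 4 * (a ^ 2 + b ^ 2) := by
        have hn := norm_nonneg (x - y)
        rcases max_cases a (2 * b) with h | h <;> rw [h.1] at h3 <;> nlinarith
      have h5 : γ / 4 * ‖x - y‖ ^ 2 ≤ γ * (a ^ 2 + b ^ 2) := by nlinarith
      refine h5.trans ?_
      simp only [Fintype.sum_sum_type, Sum.elim_inl, Sum.elim_inr]
      have e1 : ∑ i, (-drift c (x ∘ Sum.inr) (x ∘ Sum.inl) i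
          - -drift c (y ∘ Sum.inr) (y ∘ Sum.inl) i) * (x (Sum.inr i) - y (Sum.inr i))
          = -∑ i, (drift c (x ∘ Sum.inr) (x ∘ Sum.inl) i - drift c (y ∘ Sum.inr) (y ∘ Sum.inl) i)
            * ((x ∘ Sum.inr) i - (y ∘ Sum.inr) i) := by
        rw [← Finset.sum_neg_distrib]
        exact Finset.sum_congr rfl fun i _ => by simp; ring
      have e2 : ∑ i, (hamiltonian c (x ∘ Sum.inr) (x ∘ Sum.inl) i
          - hamiltonian c (y ∘ Sum.inr) (y ∘ Sum.inl) i) * (x (Sum.inl i) - y (Sum.inl i))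
          = -∑ i, ((x ∘ Sum.inl) i - (y ∘ Sum.inl) i) * (hamiltonian c (y ∘ Sum.inr) (y ∘ Sum.inl) i
            - hamiltonian c (x ∘ Sum.inr) (x ∘ Sum.inl) i) := by
        rw [← Finset.sum_neg_distrib]
        exact Finset.sum_congr rfl fun i _ => by simp; ring
      rw [e1, e2]
      linarith)
  refine ⟨x ∘ Sum.inl, hx.1.1, x ∘ Sum.inr, hx.2, fun θ' hθ' v hv => ?_⟩
  have hd' : (d : ℝ) ≠ 0 := by exact_mod_cast hd.ne'
  -- Test functions need not have mean zero: the drift sums to zero, so subtracting the mean changes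
  -- nothing.
  set r : ℝ := (∑ i, v i) / d with hr
  have h := hvi (Sum.elim θ' fun i => v i - r) ⟨⟨by simpa using hθ', by
    simp only [Sum.elim_inr, Finset.sum_sub_distrib]
    simp [hr]; field_simp; ring⟩, fun i j => by simpa using hv i j⟩
  simp only [Fintype.sum_sum_type, Sum.elim_inl, Sum.elim_inr] at h
  have e : ∑ i, -drift c (x ∘ Sum.inr) (x ∘ Sum.inl) i * (v i - r - x (Sum.inr i))
      = -∑ i, drift c (x ∘ Sum.inr) (x ∘ Sum.inl) i * (v i - x (Sum.inr i)) := by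
    have e0 : ∑ i, drift c (x ∘ Sum.inr) (x ∘ Sum.inl) i * r = 0 := by
      rw [← Finset.sum_mul, sum_drift, zero_mul]
    rw [← add_zero (-_), ← e0, ← Finset.sum_neg_distrib, ← Finset.sum_add_distrib]
    exact Finset.sum_congr rfl fun i _ => by ring
  rw [e] at h
  simpa [sub_eq_add_neg] using h

/-- Existence of a stationary solution. -/
lemma exists_isStationary (hd : 0 < d) (hc : IsRunningCost c)
    (hconc : LocallyUniformlyConcave c) (hmono : HamiltonianMonotone c) (hcontr : Contractive c) :
    ∃ (θ u : Fin d → ℝ) (κ : ℝ), IsStationary c θ u κ := by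
  obtain ⟨M, hM, hcon⟩ := hcontr
  -- Oscillation equal to `R` forces `sharpNorm` above `M`, where contractivity applies.
  set R := 2 * M + 1 with hRdef
  have hR : 0 < R := by positivity
  obtain ⟨θ, hθ, u, hu, hvi⟩ :=
    exists_stationary_variationalInequality hd hc hconc hmono hR.le
  have hd' : (0 : ℝ) < d := by exact_mod_cast hd
  set κ := ∑ i, θ i * hamiltonian c u θ i with hκ
  have hge : ∀ k, κ ≤ hamiltonian c u θ k := fun k => by
    have h := hvi (Pi.single k 1) (single_mem_stdSimplex ℝ k) u hu
    simp only [sub_self, mul_zero, Finset.sum_const_zero, sub_zero, mul_sub,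
      Finset.sum_sub_distrib] at h
    have e : ∑ i, hamiltonian c u θ i * Pi.single (M := fun _ => ℝ) k 1 i = hamiltonian c u θ k := by
      simp [Pi.single_apply]
    rw [e] at h
    simp only [hκ, mul_comm (θ _)]
    linarith
  -- Complementary slackness: `κ` is a lower bound for `h` and its `θ`-average, so mass sits only
  -- where `h = κ`.
  have hsupp : ∀ k, θ k = 0 ∨ hamiltonian c u θ k = κ := fun k => by
    have h0 : ∑ i, θ i * (hamiltonian c u θ i - κ) = 0 := by
      simp only [mul_sub, Finset.sum_sub_distrib, ← Finset.sum_mul, hθ.2]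
      rw [← hκ]; ring
    have h1 := (Finset.sum_eq_zero_iff_of_nonneg fun i _ =>
      mul_nonneg (hθ.1 i) (sub_nonneg.2 (hge i))).1 h0 k (Finset.mem_univ k)
    rcases mul_eq_zero.1 h1 with h | h
    · exact Or.inl h
    · exact Or.inr (sub_eq_zero.1 h)
  have hraise : ∀ k, ∀ ε : ℝ, 0 < ε → (∀ j, u k + ε - u j ≤ R) → drift c u θ k ≤ 0 := by
    intro k ε hε h
    have h1 := hvi θ hθ (u + (Pi.single k ε : Fin d → ℝ)) fun i j => by
      have h2 := hu i j
      by_cases hi : i = k <;> by_cases hj : j = k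
      · subst hi; subst hj; simpa using hR.le
      · subst hi; simpa [hj] using h j
      · subst hj; simp [hi]; linarith
      · simpa [hi, hj] using h2
    have e : ∑ i, drift c u θ i * ((u + (Pi.single k ε : Fin d → ℝ)) i - u i) = drift c u θ k * ε := by
      simp [Pi.single_apply]
    simp only [sub_self, mul_zero, Finset.sum_const_zero] at h1
    rw [e] at h1
    by_contra! hlt
    nlinarith [mul_pos hlt hε]
  -- If the constraint were active, `k` would be a minimum of `u`, so contractivity gives `h > κ`
  -- there and `k` is empty, with positive inflow. But `u k` can be raised by `R` within the
  -- constraint, so the drift at `k` is nonpositive.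
  have hosc : ∀ i k, u i - u k < R := by
    intro i k
    refine (hu i k).lt_of_ne fun heq => ?_
    have hs : M < sharpNorm u := by
      have := sub_le_two_mul_sharpNorm u i k
      linarith
    have h1 := (hcon θ hθ k u hs).2 fun j => by
      have := hu i j
      simp only [diff]; linarith
    have h2 : κ ≤ meanHamiltonian c u θ := by
      have h3 : ∑ _j : Fin d, κ ≤ ∑ j, hamiltonian c (diff j u) θ j :=
        Finset.sum_le_sum fun j _ => by rw [hamiltonian_diff]; exact hge j
      simp only [Finset.sum_const, Finset.card_univ, Fintype.card_fin, nsmul_eq_mul] at h3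
      rw [meanHamiltonian, one_div, ← div_eq_inv_mul, le_div_iff₀ hd']
      linarith
    rw [hamiltonian_diff] at h1
    have h4 : θ k = 0 := (hsupp k).resolve_right fun h => by linarith
    have h5 := drift_pos hc hconc hθ u h4
    have h6 := hraise k R hR fun j => by linarith [hu i j]
    linarith
  have hnonpos : ∀ k, drift c u θ k ≤ 0 := fun k => by
    have : Nonempty (Fin d) := ⟨k⟩
    obtain ⟨j, hj⟩ := Finite.exists_min u
    refine hraise k (R - (u k - u j)) (by linarith [hosc k j]) fun l => ?_
    linarith [hj l]
  have hzero : ∀ k, drift c u θ k = 0 := fun k => by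
    have h := (Finset.sum_eq_zero_iff_of_nonpos fun i _ => hnonpos i).1 (sum_drift (c := c) u θ)
    exact h k (Finset.mem_univ k)
  refine ⟨θ, u, κ, hθ, fun i => ?_, fun i => ?_⟩
  · simpa [drift] using hzero i
  · rw [hamiltonian_diff]
    refine (hsupp i).resolve_left fun h => ?_
    have := drift_pos hc hconc hθ u h
    linarith [hzero i]

/-- Uniqueness of the stationary solution. -/
lemma IsStationary.unique (hd : 0 < d) (hconc : LocallyUniformlyConcave c)
    (hmono : HamiltonianMonotone c) {θ θ' u u' : Fin d → ℝ} {κ κ' : ℝ} (h : IsStationary c θ u κ)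
    (h' : IsStationary c θ' u' κ') : θ' = θ ∧ κ' = κ ∧ ∃ r : ℝ, u' = u + fun _ => r := by
  obtain ⟨γ, hγ, hm⟩ := exists_monotone hd hconc hmono (max (sharpNorm u') (sharpNorm u))
  have h1 := hm θ' h'.mem_simplex θ h.mem_simplex u' u (le_max_left _ _) (le_max_right _ _)
  have a1 : ∀ i, hamiltonian c u θ i = κ := fun i => by simpa using h.hamiltonJacobi i
  have a2 : ∀ i, hamiltonian c u' θ' i = κ' := fun i => by simpa using h'.hamiltonJacobi i
  have b1 : ∀ i, drift c u θ i = 0 := fun i => by simpa [drift] using h.kolmogorov i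
  have b2 : ∀ i, drift c u' θ' i = 0 := fun i => by simpa [drift] using h'.kolmogorov i
  simp only [a1, a2, b1, b2, zero_mul, Finset.sum_const_zero, add_zero,
    ← Finset.sum_mul, Finset.sum_sub_distrib, h.mem_simplex.2, h'.mem_simplex.2, sub_self] at h1
  have hn1 := sq_nonneg ‖θ' - θ‖
  have hn2 := sq_nonneg (sharpNorm (u' - u))
  have e1 : ‖θ' - θ‖ ^ 2 = 0 := by nlinarith
  have e2 : sharpNorm (u' - u) ^ 2 = 0 := by nlinarith
  have hθ : θ' = θ := by simpa [sub_eq_zero] using e1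
  have hs : sharpNorm (u' - u) = 0 := by simpa using e2
  set i₀ : Fin d := ⟨0, hd⟩
  have hu : u' = u + fun _ => u' i₀ - u i₀ := by
    funext j
    have h2 := sub_le_two_mul_sharpNorm (u' - u) j i₀
    have h3 := sub_le_two_mul_sharpNorm (u' - u) i₀ j
    simp only [Pi.sub_apply, hs] at h2 h3
    simp only [Pi.add_apply]
    linarith
  refine ⟨hθ, ?_, _, hu⟩
  have hdiff : diff i₀ u' = diff i₀ u := by
    funext j
    have h4 := congrFun hu j
    simp only [Pi.add_apply] at h4
    simp only [diff, h4]
    ring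
  rw [← h.hamiltonJacobi i₀, ← h'.hamiltonJacobi i₀, hθ, hdiff]

/-! ### A priori bound on the oscillation. -/

/-- Backward propagation of bounds. -/
lemma Contractive.exists_sharpNorm_le (hd : 0 < d) (hcontr : Contractive c) :
    ∃ M₀ : ℝ, ∀ M : ℝ, M₀ ≤ M → ∀ (a b : ℝ) (θ u : ℝ → Fin d → ℝ), IsSolution c a b θ u →
      sharpNorm (u b) ≤ M → ∀ t ∈ Icc a b, sharpNorm (u t) ≤ M := by
  obtain ⟨M₀, -, hcon⟩ := hcontr
  refine ⟨M₀, fun M hM a b θ u hsol hub t₀ ht₀ => ?_⟩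
  by_contra! hlt
  have hne : (Icc t₀ b).Nonempty := ⟨t₀, le_rfl, ht₀.2⟩
  have hcont : ∀ i, ContinuousOn (fun t => u t i) (Icc t₀ b) := fun i t ht =>
    ((hsol.hamiltonJacobi t ⟨ht₀.1.trans ht.1, ht.2⟩ i).continuousWithinAt).mono
      (Icc_subset_Icc_left ht₀.1)
  have hmax : ∀ p : Fin d × Fin d, ∃ t ∈ Icc t₀ b, ∀ s ∈ Icc t₀ b,
      u s p.1 - u s p.2 ≤ u t p.1 - u t p.2 := fun p =>
    isCompact_Icc.exists_isMaxOn hne ((hcont p.1).sub (hcont p.2))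
  choose τ hτ hτmax using hmax
  have : Nonempty (Fin d × Fin d) := ⟨⟨⟨0, hd⟩, ⟨0, hd⟩⟩⟩
  -- Maximizing over times and pairs makes `i` a maximum and `k` a minimum of `u t₁`.
  obtain ⟨⟨i, k⟩, hp⟩ := Finite.exists_max fun p => u (τ p) p.1 - u (τ p) p.2
  set t₁ := τ (i, k)
  have ht₁ : t₁ ∈ Icc t₀ b := hτ (i, k)
  have hall : ∀ s ∈ Icc t₀ b, ∀ i' k', u s i' - u s k' ≤ u t₁ i - u t₁ k := fun s hs i' k' =>
    (hτmax (i', k') s hs).trans (hp (i', k'))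
  obtain ⟨i₀, k₀, h0⟩ : ∃ i₀ k₀, 2 * M < u t₀ i₀ - u t₀ k₀ := by
    by_contra! h
    exact hlt.not_ge ((sharpNorm_le_iff hd).2 h)
  have hbig : 2 * M < u t₁ i - u t₁ k := h0.trans_le (hall t₀ ⟨le_rfl, ht₀.2⟩ i₀ k₀)
  have hsharp : M₀ < sharpNorm (u t₁) := by
    have := sub_le_two_mul_sharpNorm (u t₁) i k
    linarith
  have htb : t₁ < b := by
    refine ht₁.2.lt_of_ne fun h => ?_
    have := (sharpNorm_le_iff hd).1 hub i k
    rw [← h] at this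
    linarith
  have ht₁' : t₁ ∈ Icc a b := ⟨ht₀.1.trans ht₁.1, ht₁.2⟩
  have hθ := hsol.mem_simplex t₁ ht₁'
  have h1 := (hcon (θ t₁) hθ i (u t₁) hsharp).1 fun j => by
    have := hall t₁ ht₁ j k
    simp only [diff]; linarith
  have h2 := (hcon (θ t₁) hθ k (u t₁) hsharp).2 fun j => by
    have := hall t₁ ht₁ i j
    simp only [diff]; linarith
  -- The right derivative of `u i - u k` at `t₁` is `h_k - h_i`, and contractivity puts the mean of
  -- `h` strictly between the two. It is positive, so the difference exceeds its maximum just after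
  -- `t₁`.
  have hder := ((hsol.hamiltonJacobi t₁ ht₁' i).sub (hsol.hamiltonJacobi t₁ ht₁' k)).mono
    (s := Ioc t₁ b) (fun s hs => ⟨ht₁'.1.trans hs.1.le, hs.2⟩)
  rw [hasDerivWithinAt_iff_tendsto_slope' (by simp)] at hder
  have hpos := hder.eventually (lt_mem_nhds (by linarith : (0 : ℝ) < _))
  have : (𝓝[Ioc t₁ b] t₁).NeBot := left_nhdsWithin_Ioc_neBot htb
  obtain ⟨s, hs, hst⟩ := (hpos.and self_mem_nhdsWithin).exists
  have h3 := hall s ⟨ht₁.1.trans hst.1.le, hst.2⟩ i k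
  rw [slope_def_field] at hs
  have h4 := (div_pos_iff_of_pos_right (sub_pos.2 hst.1)).1 hs
  simp only [Pi.sub_apply] at h4
  linarith

/-! ### Trend to equilibrium. -/

/-- A function with `φ' ≤ -lam |φ|` decays exponentially away from both endpoints. -/
lemma exp_decay {φ φ' : ℝ → ℝ} {a b lam C : ℝ}
    (hφ : ∀ t ∈ Icc a b, HasDerivWithinAt φ (φ' t) (Icc a b) t)
    (hle : ∀ t ∈ Icc a b, φ' t ≤ -lam * |φ t|) (hlam : 0 ≤ lam)
    (hC : ∀ t ∈ Icc a b, |φ t| ≤ C) {t : ℝ} (ht : t ∈ Icc a b) :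
    φ t ≤ C * Real.exp (-lam * (t - a)) ∧ -(C * Real.exp (-lam * (b - t))) ≤ φ t := by
  have hab : a ≤ b := ht.1.trans ht.2
  -- The case `m = lam` propagates an upper bound forward from `a`, and `m = -lam` a lower bound
  -- backward from `b`.
  have key : ∀ m : ℝ, |m| ≤ lam → AntitoneOn (fun t => φ t * Real.exp (m * t)) (Icc a b) := by
    intro m hm
    have hd : ∀ t ∈ Icc a b, HasDerivWithinAt (fun t => φ t * Real.exp (m * t))
        (φ' t * Real.exp (m * t) + φ t * (Real.exp (m * t) * m)) (Icc a b) t := fun t ht => by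
      refine (hφ t ht).mul (HasDerivAt.hasDerivWithinAt ?_)
      simpa using ((hasDerivAt_id t).const_mul m).exp
    refine antitoneOn_of_hasDerivWithinAt_nonpos (convex_Icc a b)
      (fun t ht => (hd t ht).continuousWithinAt)
      (fun t ht => (hd t (interior_subset ht)).mono interior_subset) fun t ht => ?_
    have h1 := hle t (interior_subset ht)
    have h2 : φ t * m ≤ lam * |φ t| := by
      calc φ t * m ≤ |φ t * m| := le_abs_self _
        _ = |m| * |φ t| := by rw [abs_mul, mul_comm]
        _ ≤ _ := by gcongr
    have h3 := Real.exp_pos (m * t)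
    have : φ' t * Real.exp (m * t) + φ t * (Real.exp (m * t) * m)
        = (φ' t + φ t * m) * Real.exp (m * t) := by ring
    rw [this]
    exact mul_nonpos_of_nonpos_of_nonneg (by linarith) h3.le
  constructor
  · have h1 := key lam (abs_of_nonneg hlam).le ⟨le_rfl, hab⟩ ht ht.1
    dsimp only at h1
    have h2 : φ a ≤ C := (le_abs_self _).trans (hC a ⟨le_rfl, hab⟩)
    have h3 : φ t * Real.exp (lam * t) ≤ C * Real.exp (lam * a) := h1.trans (by gcongr)
    have e : Real.exp (-lam * (t - a)) = Real.exp (lam * a) / Real.exp (lam * t) := by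
      rw [← Real.exp_sub]; ring_nf
    rw [e, mul_div_assoc', le_div_iff₀ (Real.exp_pos _)]
    exact h3
  · have h1 := key (-lam) (by rw [abs_neg, abs_of_nonneg hlam]) ht ⟨hab, le_rfl⟩ ht.2
    dsimp only at h1
    have h2 : -C ≤ φ b := (abs_le.1 (hC b ⟨hab, le_rfl⟩)).1
    have h3 : -C * Real.exp (-lam * b) ≤ φ t * Real.exp (-lam * t) := le_trans (by gcongr) h1
    have e : Real.exp (-lam * (b - t)) = Real.exp (-lam * b) / Real.exp (-lam * t) := by
      rw [← Real.exp_sub]; ring_nf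
    rw [e, mul_div_assoc', ← neg_div, div_le_iff₀ (Real.exp_pos _), ← neg_mul]
    exact h3

lemma abs_sum_mul_le_of_sum_eq_zero {p w : Fin d → ℝ} (hp : ∑ i, p i = 0) :
    |∑ i, p i * w i| ≤ d * (‖p‖ * (2 * sharpNorm w)) := by
  rcases Nat.eq_zero_or_pos d with rfl | hd
  · simp
  have e : ∑ i, p i * w i = ∑ i, p i * diff ⟨0, hd⟩ w i := by
    simp only [diff, mul_sub, Finset.sum_sub_distrib, ← Finset.sum_mul, hp]
    ring
  rw [e]
  refine (abs_sum_mul_le _ _).trans ?_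
  gcongr
  exact norm_diff_le_two_mul_sharpNorm _ w

/-- Quantitative turnpike estimate at time `0` for solutions on `[-T, T]`. -/
lemma IsStationary.exists_turnpike (hd : 0 < d) (hc : IsRunningCost c)
    (hconc : LocallyUniformlyConcave c) (hmono : HamiltonianMonotone c) {θbar ubar : Fin d → ℝ}
    {κ : ℝ} (hst : IsStationary c θbar ubar κ) (M : ℝ) :
    ∃ A C lam : ℝ, 0 ≤ A ∧ 0 < lam ∧ ∀ (T ε : ℝ) (θ u : ℝ → Fin d → ℝ), 0 < ε → ε < T →
      IsSolution c (-T) T θ u → (∀ t ∈ Icc (-T) T, sharpNorm (u t) ≤ M) →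
      ‖θ 0 - θbar‖ ≤ A * ε + √(C / ε * Real.exp (-lam * (T - ε))) ∧
      sharpNorm (u 0 - ubar) ≤ A * ε + √(C / ε * Real.exp (-lam * (T - ε))) := by
  set N := max M (sharpNorm ubar)
  have hN0 : 0 ≤ N := le_max_of_le_right (sharpNorm_nonneg _)
  obtain ⟨A, hA, hb, -⟩ := hc.exists_bound hd N
  obtain ⟨γ, hγ, hm⟩ := exists_monotone hd hconc hmono N
  have hd' : (0 : ℝ) < d := by exact_mod_cast hd
  -- Chosen since `|φ| ≤ 2 d x y ≤ d (x ^ 2 + y ^ 2)`, with `x`, `y` the distances of `θ` and `u`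
  -- from equilibrium.
  set lam := γ / d with hlam
  have hlam0 : 0 < lam := by positivity
  set C := d * (1 * (2 * (2 * N))) with hC
  refine ⟨A, 2 * C / γ, lam, hA, hlam0, fun T ε θ u hε hεT hsol hu => ?_⟩
  have huN : ∀ t ∈ Icc (-T) T, sharpNorm (u t) ≤ N := fun t ht => (hu t ht).trans (le_max_left _ _)
  have hneg : sharpNorm (-ubar) ≤ N := (sharpNorm_le_iff hd).2 fun i j => by
    have := sub_le_two_mul_sharpNorm ubar j i
    have : sharpNorm ubar ≤ N := le_max_right _ _
    simp only [Pi.neg_apply]; linarith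
  set φ : ℝ → ℝ := fun t => ∑ i, (θ t i - θbar i) * (u t i - ubar i) with hφ
  set φ' : ℝ → ℝ := fun t => ∑ i, (drift c (u t) (θ t) i * (u t i - ubar i)
    + (θ t i - θbar i) * -hamiltonian c (u t) (θ t) i) with hφ'
  have hθd : ∀ t ∈ Icc (-T) T, ∀ i, HasDerivWithinAt (fun s => θ s i)
      (drift c (u t) (θ t) i) (Icc (-T) T) t := fun t ht i => by
    simpa [drift] using hsol.kolmogorov t ht i
  have hud : ∀ t ∈ Icc (-T) T, ∀ i, HasDerivWithinAt (fun s => u s i)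
      (-hamiltonian c (u t) (θ t) i) (Icc (-T) T) t := fun t ht i => by
    simpa using hsol.hamiltonJacobi t ht i
  have hder : ∀ t ∈ Icc (-T) T, HasDerivWithinAt φ (φ' t) (Icc (-T) T) t := fun t ht =>
    HasDerivWithinAt.fun_sum fun i _ => ((hθd t ht i).sub_const _).mul ((hud t ht i).sub_const _)
  have hzero : ∀ t ∈ Icc (-T) T, ∑ i, (θ t - θbar) i = 0 := fun t ht => by
    simp [Finset.sum_sub_distrib, (hsol.mem_simplex t ht).2, hst.mem_simplex.2]
  have hφabs : ∀ t ∈ Icc (-T) T,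
      |φ t| ≤ d * (‖θ t - θbar‖ * (2 * sharpNorm (u t - ubar))) := fun t ht =>
    abs_sum_mul_le_of_sum_eq_zero (w := u t - ubar) (hzero t ht)
  have hφ'le : ∀ t ∈ Icc (-T) T,
      φ' t ≤ -γ * (‖θ t - θbar‖ ^ 2 + sharpNorm (u t - ubar) ^ 2) := fun t ht => by
    have h1 := hm (θ t) (hsol.mem_simplex t ht) θbar hst.mem_simplex (u t) ubar (huN t ht)
      (le_max_right _ _)
    have a1 : ∀ i, hamiltonian c ubar θbar i = κ := fun i => by simpa using hst.hamiltonJacobi i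
    have b1 : ∀ i, drift c ubar θbar i = 0 := fun i => by simpa [drift] using hst.kolmogorov i
    simp only [a1, b1, sub_zero] at h1
    have e : ∑ i, (θ t - θbar) i * κ = 0 := by rw [← Finset.sum_mul, hzero t ht, zero_mul]
    refine le_of_eq_of_le ?_ h1
    rw [← add_zero (φ' t), ← e, hφ', ← Finset.sum_add_distrib, ← Finset.sum_add_distrib]
    exact Finset.sum_congr rfl fun i _ => by simp only [Pi.sub_apply]; ring
  have hφ'abs : ∀ t ∈ Icc (-T) T, φ' t ≤ -lam * |φ t| := fun t ht => by
    have h1 := hφ'le t ht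
    have h2 : lam * |φ t| ≤ lam * (d * (‖θ t - θbar‖ * (2 * sharpNorm (u t - ubar)))) := by
      gcongr; exact hφabs t ht
    have h3 : lam * (d * (‖θ t - θbar‖ * (2 * sharpNorm (u t - ubar))))
        = γ * (2 * ‖θ t - θbar‖ * sharpNorm (u t - ubar)) := by
      rw [hlam]; field_simp
    have h4 := mul_le_mul_of_nonneg_left
      (two_mul_le_add_sq ‖θ t - θbar‖ (sharpNorm (u t - ubar))) hγ.le
    linarith
  have hφC : ∀ t ∈ Icc (-T) T, |φ t| ≤ C := fun t ht => by
    refine (hφabs t ht).trans ?_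
    have h1 : sharpNorm (u t - ubar) ≤ 2 * N := by
      have h2 := sharpNorm_add_le (u t) (-ubar)
      have h3 := huN t ht
      rw [← sub_eq_add_neg] at h2
      linarith
    have h0 := sharpNorm_nonneg (u t - ubar)
    have := norm_sub_le_one_of_mem_stdSimplex (hsol.mem_simplex t ht) hst.mem_simplex
    rw [hC]
    gcongr
  have hsub : Icc 0 ε ⊆ Icc (-T) T := Icc_subset_Icc (by linarith) hεT.le
  -- Smallness of `φ` alone says nothing about distances; its derivative does. The upper bound on `φ
  -- 0` and the lower bound on `φ ε` make the slope at `ξ` barely negative.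
  obtain ⟨ξ, hξ, hξe⟩ := exists_hasDerivAt_eq_slope φ φ' hε
    (fun t ht => ((hder t (hsub ht)).continuousWithinAt).mono hsub)
    (fun t ht => (hder t (hsub (Ioo_subset_Icc_self ht))).hasDerivAt
      (Icc_mem_nhds (by linarith [ht.1]) (by linarith [ht.2])))
  have hξI : ξ ∈ Icc 0 ε := Ioo_subset_Icc_self hξ
  have h0I : (0 : ℝ) ∈ Icc 0 ε := ⟨le_rfl, hε.le⟩
  have d0 := (exp_decay hder hφ'abs hlam0.le hφC (hsub h0I)).1
  have dε := (exp_decay hder hφ'abs hlam0.le hφC (hsub (right_mem_Icc.2 hε.le))).2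
  have hC0 : 0 ≤ C := by positivity
  have d0' : C * Real.exp (-lam * (0 - -T)) ≤ C * Real.exp (-lam * (T - ε)) := by
    refine mul_le_mul_of_nonneg_left (Real.exp_le_exp.2 ?_) hC0
    nlinarith
  have hsmall : ‖θ ξ - θbar‖ ^ 2 + sharpNorm (u ξ - ubar) ^ 2
      ≤ 2 * C / γ / ε * Real.exp (-lam * (T - ε)) := by
    have h1 := hφ'le ξ (hsub hξI)
    rw [hξe, sub_zero, div_le_iff₀ hε] at h1
    rw [div_div, div_mul_eq_mul_div, le_div_iff₀ (by positivity)]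
    linarith
  have hlip : ∀ f : ℝ → Fin d → ℝ, ∀ f' : ℝ → Fin d → ℝ,
      (∀ t ∈ Icc (-T) T, ∀ i, HasDerivWithinAt (fun s => f s i) (f' t i) (Icc (-T) T) t) →
      (∀ t ∈ Icc (-T) T, ∀ i, |f' t i| ≤ A) → ‖f 0 - f ξ‖ ≤ A * ε := by
    intro f f' hf hf'
    refine (pi_norm_le_iff_of_nonneg (by positivity)).2 fun i => ?_
    refine ((convex_Icc (-T) T).norm_image_sub_le_of_norm_hasDerivWithin_le
      (fun t ht => hf t ht i) (fun t ht => hf' t ht i) (hsub hξI) (hsub h0I)).trans ?_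
    gcongr
    rw [zero_sub, norm_neg, Real.norm_eq_abs, abs_of_nonneg hξI.1]
    exact hξI.2
  have hl1 := hlip θ (fun t => drift c (u t) (θ t)) hθd fun t ht =>
    abs_drift_le (hsol.mem_simplex t ht) fun j =>
      (hb j _ (hsol.mem_simplex t ht) _ (huN t ht)).1
  have hl2 := hlip u (fun t i => -hamiltonian c (u t) (θ t) i) hud fun t ht i => by
    rw [abs_neg]
    exact (hb i _ (hsol.mem_simplex t ht) _ (huN t ht)).2
  constructor
  · have h1 : ‖θ ξ - θbar‖ ≤ √(2 * C / γ / ε * Real.exp (-lam * (T - ε))) :=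
      Real.le_sqrt_of_sq_le (by linarith [sq_nonneg (sharpNorm (u ξ - ubar))])
    have h2 := norm_sub_le_norm_sub_add_norm_sub (θ 0) (θ ξ) θbar
    linarith
  · have h1 : sharpNorm (u ξ - ubar) ≤ √(2 * C / γ / ε * Real.exp (-lam * (T - ε))) :=
      Real.le_sqrt_of_sq_le (by linarith [sq_nonneg ‖θ ξ - θbar‖])
    have h2 := sharpNorm_add_le (u 0 - u ξ) (u ξ - ubar)
    rw [sub_add_sub_cancel] at h2
    have h3 := sharpNorm_le_norm (u 0 - u ξ)
    linarith

lemma tendsto_zero_of_turnpike_bound {f : ℝ → ℝ} {A C lam : ℝ} (hA : 0 ≤ A) (hlam : 0 < lam)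
    (h0 : ∀ T, 0 ≤ f T)
    (h : ∀ T ε, 0 < ε → ε < T → f T ≤ A * ε + √(C / ε * Real.exp (-lam * (T - ε)))) :
    Tendsto f atTop (𝓝 0) := by
  refine tendsto_order.2 ⟨fun a ha => Eventually.of_forall fun T => ha.trans_le (h0 T),
    fun δ hδ => ?_⟩
  -- Here `ε` is fixed before `T → ∞`; `A + 1` avoids dividing by zero.
  set ε := δ / (2 * (A + 1)) with hε
  have hε0 : 0 < ε := by positivity
  have hAε : A * ε ≤ δ / 2 := by
    rw [hε, mul_div_assoc', div_le_div_iff₀ (by positivity) (by positivity)]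
    nlinarith
  have hlim : Tendsto (fun T => √(C / ε * Real.exp (-lam * (T - ε)))) atTop (𝓝 0) := by
    have h1 : Tendsto (fun T : ℝ => -lam * (T - ε)) atTop atBot :=
      (tendsto_atTop_add_const_right _ (-ε) tendsto_id).const_mul_atTop_of_neg (by linarith)
    have h2 := (((Real.tendsto_exp_atBot.comp h1).const_mul (C / ε))).sqrt
    simpa using h2
  filter_upwards [hlim.eventually (gt_mem_nhds (half_pos hδ)), eventually_gt_atTop ε] with T h1 h2
  have := h T ε hε0 h2
  linarith

lemma IsTerminalCost.exists_bound (hd : 0 < d) {ψ : Fin d → (Fin d → ℝ) → ℝ}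
    (hψ : IsTerminalCost ψ) :
    ∃ B : ℝ, ∀ θ ∈ stdSimplex ℝ (Fin d), ‖fun i => ψ i θ‖ ≤ B := by
  obtain ⟨K, hK⟩ := hψ
  set θr : Fin d → ℝ := Pi.single ⟨0, hd⟩ 1
  have hθr : θr ∈ stdSimplex ℝ (Fin d) := single_mem_stdSimplex ℝ _
  refine ⟨‖fun i => ψ i θr‖ + K, fun θ hθ => (pi_norm_le_iff_of_nonneg (by positivity)).2
    fun i => ?_⟩
  have h1 := (hK i).norm_sub_le hθ hθr
  have h2 := norm_le_pi_norm (fun i => ψ i θr) i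
  have h3 := norm_sub_norm_le (ψ i θ) (ψ i θr)
  have h4 : (K : ℝ) * ‖θ - θr‖ ≤ K * 1 := by
    gcongr; exact norm_sub_le_one_of_mem_stdSimplex hθ hθr
  linarith

end MFG

theorem theorem2p9 {d : ℕ} (hd : 0 < d) (c : Fin d → (Fin d → ℝ) → (Fin d → ℝ) → ℝ)
    (hc : MFG.IsRunningCost c) (hconc : MFG.LocallyUniformlyConcave c)
    (hmono : MFG.HamiltonianMonotone c) (hcontr : MFG.Contractive c) :
    -- (a) backward propagation of bounds
    (∃ M₀ : ℝ, ∀ M : ℝ, M₀ ≤ M → ∀ T : ℝ, 0 < T → ∀ θ u : ℝ → Fin d → ℝ,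
      MFG.IsSolution c 0 T θ u → MFG.sharpNorm (u T) ≤ M →
        ∀ t ∈ Icc (0 : ℝ) T, MFG.sharpNorm (u t) ≤ M) ∧
    ∃ (θbar ubar : Fin d → ℝ) (κ : ℝ),
      -- (b) there is a stationary solution, unique up to constants in the second component
      MFG.IsStationary c θbar ubar κ ∧
      (∀ (θ' u' : Fin d → ℝ) (κ' : ℝ), MFG.IsStationary c θ' u' κ' →
        θ' = θbar ∧ κ' = κ ∧ ∃ r : ℝ, u' = ubar + fun _ => r) ∧
      -- (c) trend to equilibrium
      (∀ θ₀ ∈ stdSimplex ℝ (Fin d), ∀ ψ : Fin d → (Fin d → ℝ) → ℝ, MFG.IsTerminalCost ψ →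
        ∀ θ u : ℝ → ℝ → Fin d → ℝ,
          (∀ T : ℝ, 0 < T → MFG.IsSolution c (-T) T (θ T) (u T) ∧ θ T (-T) = θ₀ ∧
            ∀ i, u T T i = ψ i (θ T T)) →
          Tendsto (fun T => θ T 0) atTop (𝓝 θbar) ∧
          Tendsto (fun T => MFG.sharpNorm (u T 0 - ubar)) atTop (𝓝 0)) := by
  obtain ⟨M₀, hM₀⟩ := hcontr.exists_sharpNorm_le hd
  obtain ⟨θbar, ubar, κ, hst⟩ := MFG.exists_isStationary hd hc hconc hmono hcontr
  refine ⟨⟨M₀, fun M hM T _ θ u => hM₀ M hM 0 T θ u⟩, θbar, ubar, κ, hst,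
    fun θ' u' κ' h => hst.unique hd hconc hmono h, fun θ₀ _ ψ hψ θ u hsol => ?_⟩
  obtain ⟨B, hB⟩ := hψ.exists_bound hd
  -- Terminal data are bounded by `B` on the simplex, so this bound propagates to all times
  -- independently of `T`.
  obtain ⟨A, C, lam, hA, hlam, h⟩ := hst.exists_turnpike hd hc hconc hmono (max M₀ B)
  have key : ∀ T ε : ℝ, 0 < ε → ε < T →
      ‖θ T 0 - θbar‖ ≤ A * ε + √(C / ε * Real.exp (-lam * (T - ε))) ∧
      MFG.sharpNorm (u T 0 - ubar) ≤ A * ε + √(C / ε * Real.exp (-lam * (T - ε))) := by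
    intro T ε hε hεT
    have hT : 0 < T := hε.trans hεT
    obtain ⟨hs, -, hterm⟩ := hsol T hT
    refine h T ε (θ T) (u T) hε hεT hs (hM₀ _ (le_max_left _ _) _ _ _ _ hs ?_)
    refine (MFG.sharpNorm_le_norm _).trans (le_max_of_le_right ?_)
    rw [funext hterm]
    exact hB _ (hs.mem_simplex T ⟨by linarith, le_rfl⟩)
  refine ⟨tendsto_iff_norm_sub_tendsto_zero.2 ?_, ?_⟩
  · exact MFG.tendsto_zero_of_turnpike_bound hA hlam (fun _ => norm_nonneg _)
      fun T ε h1 h2 => (key T ε h1 h2).1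
  · exact MFG.tendsto_zero_of_turnpike_bound hA hlam (fun _ => MFG.sharpNorm_nonneg _)
      fun T ε h1 h2 => (key T ε h1 h2).2
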